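/- All spaces are real; a locally convex space is a Hausdorff locally convex topological vector space. For a set $A$ write $\mathrm{co}(A)$ for its convex hull, $\overline{\mathrm{co}}(A)$ for the closure of $\mathrm{co}(A)$, and $s\text{-}\mathrm{co}(A)$ for the set of all sums of convergent series $\sum_{i\ge1}a_ix_i$ with $x_i\in A$, $a_i\ge 0$, $\sum_i a_i=1$. Definitions. A locally convex space $E$ is an SBM-space if (i) every closed bounded convex subset of $E$ is sequentially complete; (ii) for every bounded $M\subseteq E$ and every $x\in\overline M$ there is a sequence in $M$ converging to $x$; (iii) every separable bounded subset of $E$ is metrizable. A nonempty bounded set $B\subseteq E$ is dentable (respectively s-dentable, f-dentable) if for every absolutely convex neighborhood $V$ of zero in $E$ there is $x\in B$ with $x\notin\overline{\mathrm{co}}(B\setminus(x+V))$ (respectively $x\notin s\text{-}\mathrm{co}(B\setminus(x+V))$, $x\notin\mathrm{co}(B\setminus(x+V))$). A continuous linear operator $T:X\to Y$ between Banach spaces is an RN-operator if for every finite measure space $(\Omega,\Sigma,\mu)$ and every countably additive measure $m:\Sigma\to X$ of bounded variation with $m\ll\mu$ there is a Bochner integrable $f:\Omega\to Y$ with $T(m(A))=\int_A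 f\,d\mu$ for all $A\in\Sigma$. For a nonempty complete bounded absolutely convex $B\subseteq E$ let $E_B=\bigcup_n nB$ with the Minkowski functional of $B$ as norm (a Banach space), and $\phi_B:E_B\to E$ the inclusion; for an absolutely convex neighborhood $V$ of zero in a locally convex space $F$ let $\hat F_V$ be the completion of the normed space obtained from $F$ with the Minkowski functional $\rho_V$ of $V$ by identifying points at $\rho_V$-distance zero, and $\Psi_V:F\to\hat F_V$ the natural map. A continuous linear $T:E\to F$ is an RN-operator if $\Psi_V\circ T\circ\phi_B:E_B\to\hat F_V$ is an RN-operator between Banach spaces for all such $B$ and $V$. The space $E$ has the Radon–Nikodym property if the identity $E\to E$ is an RN-operator. Statement. For every SBM-space $E$ the following are equivalent: (1) $E$ has the Radon–Nikodym property; (2) every nonempty bounded set in $E$ is dentable; (3) every nonempty bounded set in $E$ is s-dentable; (4) every nonempty bounded set in $E$ is f-dentable. Moreover, every quasi-complete locally convex space all of whose bounded subsets are metrizable is an SBM-space, and so is every Fréchet space; hence the equivalence holds in particular for these spaces. -/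

import Mathlib

open Filter Topology MeasureTheory Set
open scoped Pointwise ENNReal

universe w u v

noncomputable section

/-! ### Radon–Nikodym operators between Banach spaces -/

/-- A continuous linear operator `T : X → Y` between Banach spaces is a Radon–Nikodym operator
if for every finite measure space `(Ω, Σ, μ)` and every countably additive `X`-valued measure `m`
of bounded variation with `m ≪ μ`, the measure `T ∘ m` has a Bochner integrable density with
respect to `μ`. -/
def IsBanachRNOperator {X : Type u} {Y : Type v}
    [NormedAddCommGroup X] [NormedSpace ℝ X] [CompleteSpace X]
    [NormedAddCommGroup Y] [NormedSpace ℝ Y] [CompleteSpace Y] (T : X →L[ℝ] Y) : Prop :=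
  ∀ (Ω : Type w) [MeasurableSpace Ω] (μ : Measure Ω) [IsFiniteMeasure μ]
    (m : VectorMeasure Ω X),
    m.variation univ ≠ ∞ → m ≪ᵥ μ.toENNRealVectorMeasure →
      ∃ f : Ω → Y, Integrable f μ ∧ ∀ A, MeasurableSet A → T (m A) = ∫ ω in A, f ω ∂μ

/-! ### The Banach space `E_B` of a complete bounded absolutely convex set `B` -/

/-- A (nonempty) complete, bounded, absolutely convex subset of `E`. -/
structure CompleteDisk (E : Type u) [AddCommGroup E] [Module ℝ E] [UniformSpace E] where
  carrier : Set E
  nonempty : carrier.Nonempty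
  isComplete : IsComplete carrier
  absConvex : AbsConvex ℝ carrier
  isBounded : Bornology.IsVonNBounded ℝ carrier

namespace CompleteDisk

section Algebra

variable {E : Type u} [AddCommGroup E] [Module ℝ E] [UniformSpace E] (B : CompleteDisk E)

theorem zero_mem : (0 : E) ∈ B.carrier := B.absConvex.1.zero_mem B.nonempty

/-- The linear subspace `⋃ₙ n B` of `E`. -/
def submodule : Submodule ℝ E where
  carrier := {x | ∃ n : ℕ, x ∈ (n : ℝ) • B.carrier}
  zero_mem' := ⟨0, 0, B.zero_mem, by simp⟩
  add_mem' := by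
    rintro x y ⟨n, hx⟩ ⟨k, hy⟩
    refine ⟨n + k, ?_⟩
    push_cast
    rw [B.absConvex.2.add_smul (Nat.cast_nonneg n) (Nat.cast_nonneg k)]
    exact add_mem_add hx hy
  smul_mem' := by
    rintro c x ⟨n, b, hb, rfl⟩
    obtain ⟨k, hk⟩ := exists_nat_ge (‖c‖ * n)
    refine ⟨k, ?_⟩
    have h : (c * n) • B.carrier ⊆ (k : ℝ) • B.carrier := by
      apply B.absConvex.1.smul_mono
      simpa using hk
    refine h ⟨b, hb, ?_⟩
    simp [mul_smul]

/-- The space `E_B = ⋃ₙ n B`, to be normed by the Minkowski functional of `B`. -/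
def Space : Type u := B.submodule

instance : AddCommGroup B.Space := inferInstanceAs (AddCommGroup B.submodule)

instance : Module ℝ B.Space := inferInstanceAs (Module ℝ B.submodule)

/-- The inclusion `E_B → E` as a linear map. -/
def inclₗ : B.Space →ₗ[ℝ] E := B.submodule.subtype

theorem inclₗ_injective : Function.Injective B.inclₗ := B.submodule.injective_subtype

/-- `B` as a subset of `E_B`. -/
def unitSet : Set B.Space := B.inclₗ ⁻¹' B.carrier

theorem unitSet_balanced : Balanced ℝ B.unitSet := by
  rintro a ha _ ⟨x, hx, rfl⟩
  change B.inclₗ (a • x) ∈ B.carrier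
  rw [map_smul]
  exact B.absConvex.1 a ha ⟨_, hx, rfl⟩

theorem unitSet_convex : Convex ℝ B.unitSet := B.absConvex.2.linear_preimage B.inclₗ

theorem mem_smul_unitSet {x : B.Space} {r : ℝ} (hr : r ≠ 0) :
    x ∈ r • B.unitSet ↔ B.inclₗ x ∈ r • B.carrier := by
  rw [mem_smul_set_iff_inv_smul_mem₀ hr, mem_smul_set_iff_inv_smul_mem₀ hr, ← map_smul]
  rfl

theorem unitSet_absorbent : Absorbent ℝ B.unitSet := by
  rw [absorbent_iff_forall_absorbs_singleton]
  rintro x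
  obtain ⟨n, b, hb, hx⟩ := x.2
  refine Absorbs.of_norm ⟨n + 1, fun c hc => ?_⟩
  have hc0 : c ≠ 0 := by
    rintro rfl
    rw [norm_zero] at hc
    have : (0 : ℝ) ≤ n := Nat.cast_nonneg n
    linarith
  rw [singleton_subset_iff, B.mem_smul_unitSet hc0]
  have h : (n : ℝ) • B.carrier ⊆ c • B.carrier := by
    apply B.absConvex.1.smul_mono
    rw [Real.norm_of_nonneg (Nat.cast_nonneg n)]
    linarith
  exact h ⟨b, hb, hx⟩

/-- The Minkowski functional of `B` on `E_B`, `x ↦ inf {r > 0 | x ∈ r B}`. -/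
def gaugeOn : Seminorm ℝ B.Space :=
  gaugeSeminorm B.unitSet_balanced B.unitSet_convex B.unitSet_absorbent

theorem mem_of_gaugeOn_lt {x : B.Space} {r : ℝ} (h : B.gaugeOn x < r) :
    B.inclₗ x ∈ r • B.carrier := by
  obtain ⟨s, hs0, hsr, hs⟩ := exists_lt_of_gauge_lt B.unitSet_absorbent h
  rw [B.mem_smul_unitSet hs0.ne'] at hs
  refine B.absConvex.1.smul_mono ?_ hs
  simp only [Real.norm_eq_abs]
  rw [abs_of_pos hs0, abs_of_pos (hs0.trans hsr)]
  exact hsr.le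

theorem gaugeOn_le_of_mem {x : B.Space} {r : ℝ} (hr : 0 < r) (h : B.inclₗ x ∈ r • B.carrier) :
    B.gaugeOn x ≤ r :=
  gauge_le_of_mem hr.le ((B.mem_smul_unitSet hr.ne').2 h)

/-- Every neighborhood of zero contains the image of a ball of the Minkowski functional. -/
theorem exists_gaugeOn_lt {U : Set E} (hU : U ∈ 𝓝 (0 : E)) :
    ∃ δ : ℝ, 0 < δ ∧ ∀ x : B.Space, B.gaugeOn x < δ → B.inclₗ x ∈ U := by
  obtain ⟨r, hr, h⟩ := (B.isBounded hU).exists_pos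
  refine ⟨r⁻¹, inv_pos.2 hr, fun x hx => ?_⟩
  obtain ⟨b, hb, hbx⟩ := B.mem_of_gaugeOn_lt hx
  obtain ⟨y, hy, rfl⟩ := h r (by rw [Real.norm_eq_abs, abs_of_pos hr]) hb
  rw [← hbx]
  simpa [smul_smul, hr.ne'] using hy

end Algebra

section Norm

variable {E : Type u} [AddCommGroup E] [Module ℝ E] [UniformSpace E] [IsUniformAddGroup E]
  [ContinuousSMul ℝ E] [T2Space E] (B : CompleteDisk E)

theorem eq_zero_of_gaugeOn_eq_zero {x : B.Space} (hx : B.gaugeOn x = 0) : x = 0 := by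
  apply B.inclₗ_injective
  rw [map_zero]
  by_contra hne
  obtain ⟨δ, hδ, h⟩ := B.exists_gaugeOn_lt (isOpen_ne.mem_nhds (Ne.symm hne))
  exact h x (hx ▸ hδ) rfl

/-- `E_B` is normed by the Minkowski functional of `B`. -/
instance : NormedAddCommGroup B.Space :=
  AddGroupNorm.toNormedAddCommGroup
    { B.gaugeOn.toAddGroupSeminorm with
      eq_zero_of_map_eq_zero' := fun _ h => B.eq_zero_of_gaugeOn_eq_zero h }

instance : NormedSpace ℝ B.Space where
  norm_smul_le c x := (map_smul_eq_mul B.gaugeOn c x).le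

theorem norm_def (x : B.Space) : ‖x‖ = B.gaugeOn x := rfl

/-- The natural (continuous) inclusion `φ_B : E_B → E`. -/
def incl : B.Space →L[ℝ] E where
  toLinearMap := B.inclₗ
  cont := by
    refine continuous_of_continuousAt_zero B.inclₗ ?_
    rw [ContinuousAt, map_zero, (Metric.nhds_basis_ball).tendsto_left_iff]
    intro U hU
    obtain ⟨δ, hδ, h⟩ := B.exists_gaugeOn_lt hU
    exact ⟨δ, hδ, fun x hx => h x (by rwa [mem_ball_zero_iff] at hx)⟩

/-- As `B` is complete, `E_B` is a Banach space. -/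
instance : CompleteSpace B.Space := by
  refine Metric.complete_of_cauchySeq_tendsto fun f hf => ?_
  obtain ⟨R, hR0, hR⟩ := cauchySeq_bdd hf
  -- all `f n - f 0` lie in `R B`, which is complete
  have key : ∀ r : ℝ, IsComplete (r • B.carrier) := fun r => by
    rcases eq_or_ne r 0 with rfl | hr
    · rw [zero_smul_set B.nonempty]
      exact (Set.finite_singleton (0 : E)).isCompact.isComplete
    · have he : IsUniformInducing (fun x : E => r • x) :=
        ((ContinuousLinearEquiv.smulLeft (Units.mk0 r hr) : E ≃L[ℝ] E)).isUniformEmbedding.1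
      exact (he.isComplete_iff (s := B.carrier)).2 B.isComplete
  have hcau : CauchySeq fun n => B.incl (f n - f 0) := by
    have : CauchySeq fun n => f n - f 0 :=
      (uniformContinuous_id.sub uniformContinuous_const).comp_cauchySeq hf
    exact B.incl.uniformContinuous.comp_cauchySeq this
  obtain ⟨z, hz, hlim⟩ := cauchySeq_tendsto_of_isComplete (key R) (fun n =>
    B.mem_of_gaugeOn_lt (by have := hR n 0; rwa [dist_eq_norm] at this)) hcau
  obtain ⟨b, hb, rfl⟩ := hz
  obtain ⟨k, hk⟩ := exists_nat_ge R
  have hmem : R • b ∈ B.submodule :=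
    ⟨k, B.absConvex.1.smul_mono (by simpa [abs_of_pos hR0] using hk) ⟨b, hb, rfl⟩⟩
  let x : B.Space := ⟨R • b, hmem⟩
  refine ⟨x + f 0, Metric.tendsto_atTop.2 fun ε hε => ?_⟩
  obtain ⟨N, hN⟩ := Metric.cauchySeq_iff.1 hf (ε / 2) (by positivity)
  refine ⟨N, fun n hn => lt_of_le_of_lt ?_ (half_lt_self hε)⟩
  rw [dist_eq_norm, B.norm_def]
  apply B.gaugeOn_le_of_mem (by positivity)
  have hlim2 : Tendsto (fun j => B.incl (f n - f 0) - B.incl (f j - f 0)) atTop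
      (𝓝 (B.incl (f n - f 0) - R • b)) := tendsto_const_nhds.sub hlim
  have hx : B.inclₗ (f n - (x + f 0)) = B.incl (f n - f 0) - R • b := by
    have : f n - (x + f 0) = (f n - f 0) - x := by abel
    rw [this, map_sub]
    rfl
  rw [hx]
  refine (key (ε / 2)).isClosed.mem_of_tendsto hlim2 ?_
  filter_upwards [eventually_ge_atTop N] with j hj
  have h1 : B.incl (f n - f 0) - B.incl (f j - f 0) = B.inclₗ (f n - f j) := by
    rw [← map_sub, sub_sub_sub_cancel_right]
    rfl
  rw [h1]
  refine B.mem_of_gaugeOn_lt ?_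
  have := hN n hn j hj
  rwa [dist_eq_norm] at this

end Norm

end CompleteDisk

/-! ### The Banach space `F̂_V` of an absolutely convex neighborhood `V` of zero -/

/-- An absolutely convex neighborhood of zero in `F`. -/
structure AbsConvexNhd (F : Type v) [AddCommGroup F] [Module ℝ F] [TopologicalSpace F] where
  carrier : Set F
  mem_nhds : carrier ∈ 𝓝 (0 : F)
  absConvex : AbsConvex ℝ carrier

namespace AbsConvexNhd

variable {F : Type v} [AddCommGroup F] [Module ℝ F] [TopologicalSpace F]
  [IsTopologicalAddGroup F] [ContinuousSMul ℝ F] (V : AbsConvexNhd F)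

/-- The Minkowski functional of `V`. -/
def gaugeOn : Seminorm ℝ F :=
  gaugeSeminorm V.absConvex.1 V.absConvex.2 (absorbent_nhds_zero V.mem_nhds)

/-- The space `F` with the seminorm given by the Minkowski functional of `V`. -/
def Space (_V : AbsConvexNhd F) : Type v := F

instance : AddCommGroup V.Space := inferInstanceAs (AddCommGroup F)

instance : Module ℝ V.Space := inferInstanceAs (Module ℝ F)

instance : SeminormedAddCommGroup V.Space :=
  AddGroupSeminorm.toSeminormedAddCommGroup (E := V.Space) V.gaugeOn.toAddGroupSeminorm

instance : NormedSpace ℝ V.Space where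
  norm_smul_le c x := (map_smul_eq_mul V.gaugeOn c x).le

/-- The identity map from `F` to the seminormed space `(F, ρ_V)`. -/
def toSpace : F →L[ℝ] V.Space where
  toFun x := x
  map_add' _ _ := rfl
  map_smul' _ _ := rfl
  cont := by
    let g : F →+ V.Space := { toFun := fun x => x, map_zero' := rfl, map_add' := fun _ _ => rfl }
    refine continuous_of_continuousAt_zero g ?_
    rw [ContinuousAt, map_zero, tendsto_zero_iff_norm_tendsto_zero]
    exact tendsto_gauge_nhds_zero V.mem_nhds

/-- The Banach space `F̂_V`: the completion of the normed space obtained from `(F, ρ_V)` by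
identifying `x` and `y` whenever `ρ_V (x - y) = 0`. -/
abbrev BanachSpace : Type v := UniformSpace.Completion (SeparationQuotient V.Space)

/-- The natural map `Ψ_V : F → F̂_V`. -/
def toBanachSpace : F →L[ℝ] V.BanachSpace :=
  UniformSpace.Completion.toComplL ∘L SeparationQuotient.mkCLM ℝ V.Space ∘L V.toSpace

theorem norm_toBanachSpace (x : F) : ‖V.toBanachSpace x‖ = gauge V.carrier x := by
  change ‖((SeparationQuotient.mk (V.toSpace x) : SeparationQuotient V.Space) :
    V.BanachSpace)‖ = _
  rw [UniformSpace.Completion.norm_coe, SeparationQuotient.norm_mk]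
  rfl

end AbsConvexNhd

/-! ### Radon–Nikodym operators between locally convex spaces -/

/-- A continuous linear operator `T : E → F` between locally convex spaces is a Radon–Nikodym
operator if for every complete bounded absolutely convex `B ⊆ E` and every absolutely convex
neighborhood `V` of zero in `F` the natural operator `Ψ_V ∘ T ∘ φ_B : E_B → F̂_V` is a
Radon–Nikodym operator between Banach spaces. -/
def IsRNOperator {E : Type u} {F : Type v}
    [AddCommGroup E] [Module ℝ E] [UniformSpace E] [IsUniformAddGroup E] [ContinuousSMul ℝ E]
    [T2Space E]
    [AddCommGroup F] [Module ℝ F] [TopologicalSpace F] [IsTopologicalAddGroup F]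
    [ContinuousSMul ℝ F] (T : E →L[ℝ] F) : Prop :=
  ∀ (B : CompleteDisk E) (V : AbsConvexNhd F),
    IsBanachRNOperator.{w} (V.toBanachSpace ∘L T ∘L B.incl)

/-! ### Dentability -/

section Dentability

variable {E : Type u} {F : Type v} [AddCommGroup E] [Module ℝ E] [TopologicalSpace E]
  [AddCommGroup F] [Module ℝ F] [TopologicalSpace F]

/-- The s-convex hull: all sums of convergent series `∑ aᵢ xᵢ` with `xᵢ ∈ A`, `aᵢ ≥ 0` and
`∑ aᵢ = 1`. -/
def sConvexHull (A : Set E) : Set E :=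
  {x | ∃ (a : ℕ → ℝ) (y : ℕ → E), (∀ i, 0 ≤ a i) ∧ (∀ i, y i ∈ A) ∧ HasSum a 1 ∧
    Tendsto (fun n => ∑ i ∈ Finset.range n, a i • y i) atTop (𝓝 x)}

/-- `B` is `T`-dentable. -/
def IsDentableFor (T : E →L[ℝ] F) (B : Set E) : Prop :=
  ∀ V ∈ 𝓝 (0 : F), AbsConvex ℝ V →
    ∃ x ∈ B, x ∉ closure (convexHull ℝ (B \ T ⁻¹' (T x +ᵥ V)))

/-- `B` is `T`-s-dentable. -/
def IsSDentableFor (T : E →L[ℝ] F) (B : Set E) : Prop :=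
  ∀ V ∈ 𝓝 (0 : F), AbsConvex ℝ V →
    ∃ x ∈ B, x ∉ sConvexHull (B \ T ⁻¹' (T x +ᵥ V))

/-- `B` is `T`-f-dentable. -/
def IsFDentableFor (T : E →L[ℝ] F) (B : Set E) : Prop :=
  ∀ V ∈ 𝓝 (0 : F), AbsConvex ℝ V →
    ∃ x ∈ B, x ∉ convexHull ℝ (B \ T ⁻¹' (T x +ᵥ V))

end Dentability

/-- Dentability of a set is dentability with respect to the identity operator. -/
def IsDentable {E : Type u} [AddCommGroup E] [Module ℝ E] [TopologicalSpace E]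
    (B : Set E) : Prop :=
  IsDentableFor (ContinuousLinearMap.id ℝ E) B

/-- s-dentability of a set is s-dentability with respect to the identity operator. -/
def IsSDentable {E : Type u} [AddCommGroup E] [Module ℝ E] [TopologicalSpace E]
    (B : Set E) : Prop :=
  IsSDentableFor (ContinuousLinearMap.id ℝ E) B

/-- f-dentability of a set is f-dentability with respect to the identity operator. -/
def IsFDentable {E : Type u} [AddCommGroup E] [Module ℝ E] [TopologicalSpace E]
    (B : Set E) : Prop :=
  IsFDentableFor (ContinuousLinearMap.id ℝ E) B

/-! ### Classes of locally convex spaces -/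

section Spaces

variable (E : Type u) [AddCommGroup E] [Module ℝ E] [UniformSpace E]

/-- The Radon–Nikodym property: the identity operator is a Radon–Nikodym operator. -/
def HasRNP [IsUniformAddGroup E] [ContinuousSMul ℝ E] [T2Space E] : Prop :=
  IsRNOperator.{w} (ContinuousLinearMap.id ℝ E)

/-- Every Cauchy sequence in `S` converges to a point of `S`. -/
def IsSeqCompleteSet {E : Type u} [UniformSpace E] (S : Set E) : Prop :=
  ∀ x : ℕ → E, (∀ n, x n ∈ S) → CauchySeq x → ∃ y ∈ S, Tendsto x atTop (𝓝 y)

/-- SBM-spaces. -/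
structure IsSBMSpace : Prop where
  seqComplete : ∀ S : Set E, IsClosed S → Bornology.IsVonNBounded ℝ S → Convex ℝ S →
    IsSeqCompleteSet S
  exists_seq : ∀ M : Set E, Bornology.IsVonNBounded ℝ M → ∀ x ∈ closure M,
    ∃ y : ℕ → E, (∀ n, y n ∈ M) ∧ Tendsto y atTop (𝓝 x)
  metrizable : ∀ S : Set E, Bornology.IsVonNBounded ℝ S → TopologicalSpace.SeparableSpace S →
    TopologicalSpace.MetrizableSpace S

/-- Every bounded subset is metrizable in the induced topology. -/
def HasMetrizableBoundedSets : Prop :=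
  ∀ S : Set E, Bornology.IsVonNBounded ℝ S → TopologicalSpace.MetrizableSpace S

/-- Fréchet spaces: complete metrizable locally convex spaces. -/
def IsFrechetSpace : Prop :=
  LocallyConvexSpace ℝ E ∧ CompleteSpace E ∧ TopologicalSpace.MetrizableSpace E

end Spaces

end

/-! The implications from dentable to s-dentable to f-dentable follow from the inclusions of the
convex hull in the s-convex hull and of the latter in the closed convex hull. The two substantial
implications connect averages of vector measures with dentability.

If bounded sets are f-dentable, let `m` be an `E_B`-valued measure with variation `ν`. Its averages
`m C / ν C` lie in the unit ball of `E_B`. A point outside the convex hull of the far averages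
yields, by exhaustion, a set of positive measure on which all averages are nearly constant
(`exists_subset_averages_close`). A second exhaustion gives simple functions which are Cauchy in
`L¹`, and their limit is the density (`exists_density_of_averages_close`).

Conversely, a non-dentable bounded set in an SBM-space contains a non-dentable sequence `b`
(`IsSBMSpace.exists_seq_mem_closure_convexHull`). Its closed absolutely convex hull `K` is a
complete disk whose topology at zero is given by countably many seminorms
(`IsSBMSpace.exists_completeDisk`). A Markov chain on the indices jumps at time `n` from `s` to
points outside `b s + V`, with mean within `2⁻ⁿ` of `b s` in the first `n + 1` seminorms: an
approximate martingale with jumps of size at least one. Its integrals over each event converge to an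
`E_K`-valued measure dominated by the law of the chain. A density of that measure in the completion
for `V` would be the `L¹`-limit of the chain (`IsMarkovChainLaw.tendsto_integral_norm_sub`), which
the jumps exclude. -/

/-- Exhaustion principle: for every property `P` of measurable sets there is a countable disjoint
family of sets of positive measure with `P` meeting every set of positive measure with `P`. -/
theorem exists_countable_disjoint_exhaustion {Ω : Type*} [MeasurableSpace Ω] (ν : Measure Ω)
    [IsFiniteMeasure ν] (P : Set Ω → Prop) :
    ∃ 𝒞 : Set (Set Ω), 𝒞.Countable ∧ 𝒞.PairwiseDisjoint id ∧
      (∀ C ∈ 𝒞, MeasurableSet C ∧ 0 < ν C ∧ P C) ∧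
      ∀ C, MeasurableSet C → 0 < ν C → P C → ¬ Disjoint C (⋃₀ 𝒞) := by
  obtain ⟨𝒞, h𝒞⟩ := zorn_subset {𝒞 : Set (Set Ω) | 𝒞.PairwiseDisjoint id ∧
    ∀ C ∈ 𝒞, MeasurableSet C ∧ 0 < ν C ∧ P C} (by
      rintro c hc hchain
      refine ⟨⋃₀ c, ⟨?_, ?_⟩, fun s hs => subset_sUnion_of_mem hs⟩
      · exact (pairwiseDisjoint_sUnion hchain.directedOn).2 fun s hs => (hc hs).1
      · rintro C ⟨s, hs, hC⟩
        exact (hc hs).2 C hC)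
  obtain ⟨hdis, hP⟩ := h𝒞.prop
  refine ⟨𝒞, ?_, hdis, hP, fun C hC hC0 hPC hd => ?_⟩
  · have := Measure.countable_meas_pos_of_disjoint_iUnion (μ := ν) (As := fun C : 𝒞 => (C : Set Ω))
      (fun C => (hP C C.2).1) (fun C D hCD => hdis C.2 D.2 (fun h => hCD (Subtype.ext h)))
    have huniv : {i : 𝒞 | 0 < ν (i : Set Ω)} = univ := eq_univ_of_forall fun C => (hP C C.2).2.1
    rw [huniv, countable_univ_iff] at this
    exact countable_coe_iff.1 this
  · have hmem : C ∈ 𝒞 := by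
      refine h𝒞.le_of_ge (y := insert C 𝒞) ⟨?_, ?_⟩ (subset_insert C 𝒞) (mem_insert C 𝒞)
      · refine hdis.insert fun D hD _ => ?_
        exact hd.mono_right (subset_sUnion_of_mem hD)
      · rintro D (rfl | hD)
        exacts [⟨hC, hC0, hPC⟩, hP D hD]
    have : C = ∅ := by simpa using hd.mono_right (subset_sUnion_of_mem hmem)
    simp [this] at hC0

/-! ### From f-dentability to densities -/

section Averages

variable {Ω : Type*} [MeasurableSpace Ω] {ν : Measure Ω} [IsFiniteMeasure ν]
  {X : Type*} [NormedAddCommGroup X] [NormedSpace ℝ X]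

/-- The average of a vector measure over the union of finitely many disjoint sets is a convex
combination of the averages over these sets. -/
theorem average_biUnion_mem_of_convex {Q : Set X} (hQ : Convex ℝ Q) (m : VectorMeasure Ω X)
    (G : Finset (Set Ω)) (hdis : (G : Set (Set Ω)).PairwiseDisjoint id)
    (hG : ∀ C ∈ G, MeasurableSet C ∧ 0 < ν C ∧ (ν.real C)⁻¹ • m C ∈ Q)
    (h0 : 0 < ν (⋃ C ∈ G, C)) :
    (ν.real (⋃ C ∈ G, C))⁻¹ • m (⋃ C ∈ G, C) ∈ Q := by
  set D := ⋃ C ∈ G, C with hD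
  have hν : ν.real D = ∑ C ∈ G, ν.real C :=
    measureReal_biUnion_finset hdis fun C hC => (hG C hC).1
  have hm : m D = ∑ C ∈ G, m C :=
    m.of_biUnion_finset hdis fun C hC => (hG C hC).1
  have hpos : 0 < ν.real D := ENNReal.toReal_pos h0.ne' (measure_ne_top _ _)
  have key : (ν.real D)⁻¹ • m D = ∑ C ∈ G, (ν.real C / ν.real D) • ((ν.real C)⁻¹ • m C) := by
    rw [hm, Finset.smul_sum]
    refine Finset.sum_congr rfl fun C hC => ?_
    have : 0 < ν.real C := ENNReal.toReal_pos (hG C hC).2.1.ne' (measure_ne_top _ _)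
    rw [smul_smul]
    congr 1
    field_simp
  rw [key]
  refine hQ.sum_mem (fun C _ => by positivity) ?_ fun C hC => (hG C hC).2.2
  rw [← Finset.sum_div, ← hν, div_self hpos.ne']

variable {Z : Type*} [NormedAddCommGroup Z] [NormedSpace ℝ Z]

/-- If finite convex combinations of averages far away from a given average never reproduce it,
then a set of positive measure contains one on which all averages are close to each other. -/
theorem exists_subset_averages_close (m : VectorMeasure Ω X)
    (hm : ∀ A, ‖m A‖ ≤ ν.real A) (T : X →L[ℝ] Z)
    (hT : ∀ S : Set X, S.Nonempty → S ⊆ Metric.closedBall 0 1 → ∀ ε : ℝ, 0 < ε →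
      ∃ x ∈ S, x ∉ convexHull ℝ {y ∈ S | ε < ‖T y - T x‖})
    {A : Set Ω} (hA : MeasurableSet A) (hA0 : 0 < ν A) {ε : ℝ} (hε : 0 < ε) :
    ∃ A' ⊆ A, MeasurableSet A' ∧ 0 < ν A' ∧
      ∃ z : Z, ∀ C ⊆ A', MeasurableSet C → ‖T (m C) - ν.real C • z‖ ≤ ε * ν.real C := by
  classical
  have hpos : ∀ {C : Set Ω}, 0 < ν C → 0 < ν.real C := fun h =>
    ENNReal.toReal_pos h.ne' (measure_ne_top _ _)
  set avg : Set Ω → X := fun C => (ν.real C)⁻¹ • m C with havg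
  obtain ⟨_, ⟨D, ⟨hDA, hDm, hD0⟩, rfl⟩, hx⟩ := hT
    (avg '' {D | D ⊆ A ∧ MeasurableSet D ∧ 0 < ν D})
    ⟨_, A, ⟨subset_rfl, hA, hA0⟩, rfl⟩
    (by
      rintro _ ⟨D, ⟨-, -, hD0⟩, rfl⟩
      rw [mem_closedBall_zero_iff, norm_smul, norm_inv, Real.norm_of_nonneg (hpos hD0).le,
        inv_mul_le_iff₀ (hpos hD0), mul_one]
      exact hm D) ε hε
  set Q := convexHull ℝ {y ∈ avg '' {D | D ⊆ A ∧ MeasurableSet D ∧ 0 < ν D} |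
    ε < ‖T y - T (avg D)‖} with hQ
  have hQmem : ∀ C, C ⊆ D → MeasurableSet C → 0 < ν C → ε < ‖T (avg C) - T (avg D)‖ →
      avg C ∈ Q := fun C hCD hC hC0 h =>
    subset_convexHull ℝ _ ⟨⟨C, ⟨hCD.trans hDA, hC, hC0⟩, rfl⟩, h⟩
  -- Exhaust `D` by disjoint sets with far averages. If they filled `D` up to a null set, the
  -- average over `D` would be a combination of far averages, contrary to the choice of `D`; so
  -- something is left over.
  obtain ⟨𝒞, hcount, hdis, h𝒞, hmax⟩ := exists_countable_disjoint_exhaustion ν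
    fun C => C ⊆ D ∧ ε < ‖T (avg C) - T (avg D)‖
  have hUm : MeasurableSet (⋃₀ 𝒞) := .sUnion hcount fun C hC => (h𝒞 C hC).1
  have hUD : ⋃₀ 𝒞 ⊆ D := sUnion_subset fun C hC => (h𝒞 C hC).2.2.1
  rcases (zero_le (a := ν (D \ ⋃₀ 𝒞))).eq_or_lt with hR | hR
  · exfalso
    apply hx
    have hνD : ν (⋃₀ 𝒞) = ν D := by
      refine le_antisymm (measure_mono hUD) ?_
      calc ν D ≤ ν (⋃₀ 𝒞 ∪ D \ ⋃₀ 𝒞) := measure_mono (by simp)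
        _ ≤ ν (⋃₀ 𝒞) + ν (D \ ⋃₀ 𝒞) := measure_union_le _ _
        _ = ν (⋃₀ 𝒞) := by rw [← hR, add_zero]
    obtain ⟨C₁, hC₁⟩ : 𝒞.Nonempty := by
      rw [nonempty_iff_ne_empty]
      rintro rfl
      simp only [sUnion_empty, measure_empty] at hνD
      exact hD0.ne hνD
    have hsum : HasSum (fun C : 𝒞 => ν.real (C : Set Ω)) (ν.real D) := by
      have h1 : ν D = ∑' C : 𝒞, ν (C : Set Ω) := by
        rw [← hνD, measure_sUnion hcount hdis fun C hC => (h𝒞 C hC).1]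
      have h2 := ENNReal.hasSum_toReal (f := fun C : 𝒞 => ν (C : Set Ω))
        (h1 ▸ measure_ne_top ν D)
      rwa [← ENNReal.tsum_toReal_eq (fun C => measure_ne_top _ _), ← h1] at h2
    -- the remainder of `D` after removing finitely many members of the family
    set R : Finset 𝒞 → Set Ω := fun F => D \ ⋃ C ∈ F, (C : Set Ω) with hRdef
    have hFm : ∀ F : Finset 𝒞, MeasurableSet (⋃ C ∈ F, (C : Set Ω)) := fun F =>
      F.measurableSet_biUnion fun C _ => (h𝒞 C C.2).1
    have hFD : ∀ F : Finset 𝒞, (⋃ C ∈ F, (C : Set Ω)) ⊆ D := fun F =>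
      iUnion₂_subset fun C _ => (h𝒞 C C.2).2.2.1
    have hRm : ∀ F, MeasurableSet (R F) := fun F => hDm.diff (hFm F)
    have hRreal : ∀ F, ν.real (R F) = ν.real D - ∑ C ∈ F, ν.real (C : Set Ω) := fun F => by
      rw [hRdef]
      simp only
      rw [measureReal_sdiff (hFD F) (hFm F), measureReal_biUnion_finset (f := Subtype.val)
        (fun C _ C' _ hCC' => hdis C.2 C'.2 fun h => hCC' (Subtype.ext h))
        fun C _ => (h𝒞 C C.2).1]
    have hRlim : Tendsto (fun F => ν.real (R F)) atTop (𝓝 0) := by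
      simp_rw [hRreal]
      simpa using hsum.const_sub (ν.real D)
    have hmRlim : Tendsto (fun F => m (R F)) atTop (𝓝 0) :=
      squeeze_zero_norm (fun F => hm (R F)) hRlim
    -- The countable family alone would give only an s-convex combination. Merging the remainder `R
    -- F` with `C₁` changes the average over `C₁` arbitrarily little, so it stays far, and `D`
    -- becomes a finite disjoint union of sets with far averages.
    have hulim : Tendsto (fun F => (ν.real C₁ + ν.real (R F))⁻¹ • (m C₁ + m (R F))) atTop
        (𝓝 (avg C₁)) := by
      have h1 : Tendsto (fun F => (ν.real C₁ + ν.real (R F))⁻¹) atTop (𝓝 (ν.real C₁)⁻¹) := by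
        have := (tendsto_const_nhds (x := ν.real C₁)).add hRlim
        rw [add_zero] at this
        exact this.inv₀ (hpos (h𝒞 C₁ hC₁).2.1).ne'
      have h2 := (tendsto_const_nhds (x := m C₁)).add hmRlim
      rw [add_zero] at h2
      exact h1.smul h2
    have hev : ∀ᶠ F in atTop, ε <
        ‖T ((ν.real C₁ + ν.real (R F))⁻¹ • (m C₁ + m (R F))) - T (avg D)‖ :=
      ((((T.continuous.tendsto _).comp hulim).sub_const _).norm).eventually_const_lt
        (h𝒞 C₁ hC₁).2.2.2
    obtain ⟨F, hF, hC₁F⟩ := (hev.and (eventually_ge_atTop {⟨C₁, hC₁⟩})).exists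
    rw [Finset.singleton_subset_iff] at hC₁F
    set F' : Finset (Set Ω) := (F.erase ⟨C₁, hC₁⟩).image Subtype.val with hF'
    have hF'mem : ∀ C ∈ F', C ∈ 𝒞 ∧ C ≠ C₁ ∧ C ⊆ ⋃ C ∈ F, (C : Set Ω) := by
      intro C hC
      rw [hF', Finset.mem_image] at hC
      obtain ⟨C', hC', rfl⟩ := hC
      rw [Finset.mem_erase] at hC'
      exact ⟨C'.2, fun h => hC'.1 (Subtype.ext h),
        subset_biUnion_of_mem (u := fun C : 𝒞 => (C : Set Ω)) hC'.2⟩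
    have hd1 : Disjoint C₁ (R F) := by
      refine disjoint_sdiff_right.mono_left ?_
      exact subset_biUnion_of_mem (u := fun C : 𝒞 => (C : Set Ω)) hC₁F
    have hGD : (⋃ C ∈ insert (C₁ ∪ R F) F', C) = D := by
      apply subset_antisymm
      · refine iUnion₂_subset fun C hC => ?_
        rw [Finset.mem_insert] at hC
        rcases hC with rfl | hC
        · exact union_subset (h𝒞 _ hC₁).2.2.1 sdiff_subset
        · exact (h𝒞 _ (hF'mem C hC).1).2.2.1
      · intro ω hω
        rw [Finset.set_biUnion_insert]
        by_cases h : ω ∈ ⋃ C ∈ F, (C : Set Ω)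
        · rw [mem_iUnion₂] at h
          obtain ⟨C, hC, hωC⟩ := h
          by_cases hCC : C = ⟨C₁, hC₁⟩
          · subst hCC
            exact Or.inl (Or.inl hωC)
          · refine Or.inr (mem_iUnion₂.2 ⟨C, ?_, hωC⟩)
            rw [hF', Finset.mem_image]
            exact ⟨C, Finset.mem_erase.2 ⟨hCC, hC⟩, rfl⟩
        · exact Or.inl (Or.inr ⟨hω, h⟩)
    have hfin := average_biUnion_mem_of_convex (ν := ν) (convex_convexHull ℝ _) m
      (insert (C₁ ∪ R F) F') (Q := Q) ?_ ?_ ?_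
    · rwa [hGD] at hfin
    · rw [Finset.coe_insert]
      refine PairwiseDisjoint.insert ?_ ?_
      · exact fun C hC C' hC' h => hdis (hF'mem C hC).1 (hF'mem C' hC').1 h
      · intro C hC _
        refine Disjoint.union_left (hdis hC₁ (hF'mem C hC).1 (hF'mem C hC).2.1.symm) ?_
        exact disjoint_sdiff_left.mono_right (hF'mem C hC).2.2
    · intro C hC
      rw [Finset.mem_insert] at hC
      rcases hC with rfl | hC
      · have hpos' : 0 < ν (C₁ ∪ R F) := (h𝒞 C₁ hC₁).2.1.trans_le (measure_mono subset_union_left)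
        refine ⟨(h𝒞 C₁ hC₁).1.union (hRm F), hpos', hQmem _ ?_
          ((h𝒞 C₁ hC₁).1.union (hRm F)) hpos' ?_⟩
        · exact union_subset (h𝒞 C₁ hC₁).2.2.1 sdiff_subset
        · rw [havg]
          simp only
          rwa [measureReal_union hd1 (hRm F), m.of_union hd1 (h𝒞 C₁ hC₁).1 (hRm F)]
      · obtain ⟨hCm, hC0, hCD, hCε⟩ := h𝒞 C (hF'mem C hC).1
        exact ⟨hCm, hC0, hQmem C hCD hCm hC0 hCε⟩
    · rwa [hGD]
  -- By maximality no subset of the leftover with positive measure has a far average, so `T (avg D)`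
  -- serves as the constant.
  · refine ⟨D \ ⋃₀ 𝒞, sdiff_subset.trans hDA, hDm.diff hUm, hR, T (avg D), fun C hC hCm => ?_⟩
    rcases (zero_le (a := ν C)).eq_or_lt with h0 | h0
    · have h0' : ν.real C = 0 := by rw [measureReal_def, ← h0]; rfl
      have : m C = 0 := norm_le_zero_iff.1 (h0' ▸ hm C)
      simp [this, h0']
    · have h1 : ¬ ε < ‖T (avg C) - T (avg D)‖ := fun h =>
        hmax C hCm h0 ⟨hC.trans sdiff_subset, h⟩ (disjoint_sdiff_left.mono_left hC)
      have h2 : T (m C) - ν.real C • T (avg D) = ν.real C • (T (avg C) - T (avg D)) := by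
        rw [smul_sub, ← map_smul T (ν.real C) (avg C), havg]
        simp only
        rw [smul_inv_smul₀ (hpos h0).ne']
      rw [h2, norm_smul, Real.norm_of_nonneg (hpos h0).le, mul_comm]
      gcongr
      exact not_lt.1 h1

/-- If every set of positive measure contains one on which the averages of `T ∘ m` are almost
constant, then `T ∘ m` is close in variation to a measure with integrable density. -/
theorem exists_integrable_approx [CompleteSpace Z] (m : VectorMeasure Ω X)
    (hm : ∀ A, ‖m A‖ ≤ ν.real A) (T : X →L[ℝ] Z)
    {ε : ℝ} (hε : 0 ≤ ε)
    (h : ∀ A, MeasurableSet A → 0 < ν A → ∃ A' ⊆ A, MeasurableSet A' ∧ 0 < ν A' ∧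
      ∃ z : Z, ∀ C ⊆ A', MeasurableSet C → ‖T (m C) - ν.real C • z‖ ≤ ε * ν.real C)
    {δ : ℝ} (hδ : 0 < δ) :
    ∃ (f : Ω → Z) (R : Set Ω), Integrable f ν ∧ MeasurableSet R ∧ ν.real R < δ ∧
      ∀ A, MeasurableSet A →
        ‖T (m A) - ∫ ω in A, f ω ∂ν‖ ≤ ε * ν.real A + ‖T‖ * ν.real (A ∩ R) := by
  classical
  obtain ⟨𝒞, hcount, hdis, h𝒞, hmax⟩ := exists_countable_disjoint_exhaustion ν
    fun A' => ∃ z : Z, ∀ C ⊆ A', MeasurableSet C → ‖T (m C) - ν.real C • z‖ ≤ ε * ν.real C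
  have hUm : MeasurableSet (⋃₀ 𝒞) := .sUnion hcount fun C hC => (h𝒞 C hC).1
  have hU : ν (⋃₀ 𝒞)ᶜ = 0 := by
    by_contra h0
    obtain ⟨A', hA', hA'm, hA'0, hz⟩ := h _ hUm.compl (pos_iff_ne_zero.2 h0)
    exact hmax A' hA'm hA'0 hz (disjoint_compl_left.mono_left hA')
  have hz : ∀ C : 𝒞, ∃ z : Z, ∀ C' ⊆ (C : Set Ω), MeasurableSet C' →
    ‖T (m C') - ν.real C' • z‖ ≤ ε * ν.real C' := fun C => (h𝒞 C C.2).2.2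
  choose z hz using hz
  have hsum : HasSum (fun C : 𝒞 => ν.real (C : Set Ω)) (ν.real univ) := by
    have h1 : ν univ = ∑' C : 𝒞, ν (C : Set Ω) := by
      rw [← measure_sUnion hcount hdis fun C hC => (h𝒞 C hC).1, ← measure_add_measure_compl hUm,
        hU, add_zero]
    have h2 := ENNReal.hasSum_toReal (f := fun C : 𝒞 => ν (C : Set Ω))
      (h1 ▸ measure_ne_top ν univ)
    rwa [← ENNReal.tsum_toReal_eq (fun C => measure_ne_top _ _), ← h1] at h2
  -- Finitely many pieces carry all but `δ` of the mass. The density is constant on each of them and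
  -- zero on the exceptional set, where only `‖m A‖ ≤ ν A` is used.
  obtain ⟨F, hF⟩ := (hsum.eventually (lt_mem_nhds (sub_lt_self (ν.real univ) hδ))).exists
  have hFdis : ((F : Set 𝒞)).PairwiseDisjoint (Subtype.val : 𝒞 → Set Ω) :=
    fun C _ C' _ hCC' => hdis C.2 C'.2 fun h => hCC' (Subtype.ext h)
  have hFm : MeasurableSet (⋃ C ∈ F, (C : Set Ω)) :=
    F.measurableSet_biUnion fun C _ => (h𝒞 C C.2).1
  refine ⟨fun ω => ∑ C ∈ F, (C : Set Ω).indicator (fun _ => z C) ω, (⋃ C ∈ F, (C : Set Ω))ᶜ,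
    ?_, hFm.compl, ?_, fun A hA => ?_⟩
  · exact integrable_finsetSum F fun C _ => (integrable_const (z C)).indicator (h𝒞 C C.2).1
  · rw [measureReal_compl hFm, measureReal_biUnion_finset (f := Subtype.val) hFdis
      fun C _ => (h𝒞 C C.2).1]
    linarith
  · have hint : ∫ ω in A, ∑ C ∈ F, (C : Set Ω).indicator (fun _ => z C) ω ∂ν =
        ∑ C ∈ F, ν.real (A ∩ C) • z C := by
      rw [integral_finsetSum F fun C _ =>
        ((integrable_const (z C)).indicator (h𝒞 C C.2).1).integrableOn]
      refine Finset.sum_congr rfl fun C _ => ?_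
      rw [integral_indicator (h𝒞 C C.2).1, Measure.restrict_restrict (h𝒞 C C.2).1,
        setIntegral_const, inter_comm]
    have hAdis : ((F : Set 𝒞)).PairwiseDisjoint fun C : 𝒞 => A ∩ (C : Set Ω) :=
      hFdis.mono fun C => inter_subset_right
    have hAm : ∀ C ∈ F, MeasurableSet (A ∩ (C : Set Ω)) := fun C _ => hA.inter (h𝒞 C C.2).1
    have hAU : A ∩ (⋃ C ∈ F, (C : Set Ω)) = ⋃ C ∈ F, A ∩ (C : Set Ω) := inter_iUnion₂ _ _
    have hmA : m A = ∑ C ∈ F, m (A ∩ C) + m (A ∩ (⋃ C ∈ F, (C : Set Ω))ᶜ) := by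
      rw [← m.of_biUnion_finset hAdis hAm, ← hAU,
        ← m.of_union (disjoint_compl_right.mono inter_subset_right inter_subset_right)
          (hA.inter hFm) (hA.inter hFm.compl), inter_union_compl]
    have hνA : ∑ C ∈ F, ν.real (A ∩ C) ≤ ν.real A := by
      rw [← measureReal_biUnion_finset hAdis hAm]
      exact measureReal_mono (iUnion₂_subset fun _ _ => inter_subset_left)
    rw [hint, hmA, map_add, map_sum, add_sub_right_comm, ← Finset.sum_sub_distrib]
    refine (norm_add_le _ _).trans (add_le_add ?_ ?_)
    · refine (norm_sum_le _ _).trans ?_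
      calc ∑ C ∈ F, ‖T (m (A ∩ C)) - ν.real (A ∩ C) • z C‖
          ≤ ∑ C ∈ F, ε * ν.real (A ∩ C) :=
            Finset.sum_le_sum fun C hC => hz C _ inter_subset_right (hAm C hC)
        _ = ε * ∑ C ∈ F, ν.real (A ∩ C) := by rw [Finset.mul_sum]
        _ ≤ ε * ν.real A := by gcongr
    · exact (T.le_opNorm _).trans (by gcongr; exact hm _)

/-- The `L¹`-norm of a function is controlled by a measure dominating its integrals. -/
theorem integral_norm_le_of_norm_setIntegral_le [CompleteSpace Z] {μ ρ : Measure Ω}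
    [IsFiniteMeasure ρ] {g : Ω → Z} (hg : Integrable g μ)
    (h : ∀ A, MeasurableSet A → ‖∫ ω in A, g ω ∂μ‖ ≤ ρ.real A) :
    ∫ ω, ‖g ω‖ ∂μ ≤ ρ.real univ := by
  -- The variation is the least measure dominating the norms setwise, and for `g` times `μ` it is
  -- `‖g‖` times `μ`.
  have h1 : (μ.withDensityᵥ g).variation ≤ ρ := by
    refine VectorMeasure.variation_le_of_forall_enorm_le fun A hA => ?_
    rw [withDensityᵥ_apply hg hA, ← ofReal_norm, ← ofReal_measureReal]
    exact ENNReal.ofReal_le_ofReal (h A hA)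
  rw [Measure.variation_withDensityᵥ hg] at h1
  have h2 := h1 univ
  rw [withDensity_apply _ MeasurableSet.univ, Measure.restrict_univ] at h2
  rw [integral_norm_eq_lintegral_enorm hg.1]
  exact ENNReal.toReal_mono (measure_ne_top _ _) h2

/-- A dominated vector measure whose averages are almost constant on small sets has a density. -/
theorem exists_density_of_averages_close [CompleteSpace Z] (m : VectorMeasure Ω X)
    (hm : ∀ A, ‖m A‖ ≤ ν.real A) (T : X →L[ℝ] Z)
    (h : ∀ ε : ℝ, 0 < ε → ∀ A, MeasurableSet A → 0 < ν A → ∃ A' ⊆ A, MeasurableSet A' ∧ 0 < ν A' ∧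
      ∃ z : Z, ∀ C ⊆ A', MeasurableSet C → ‖T (m C) - ν.real C • z‖ ≤ ε * ν.real C) :
    ∃ f : Ω → Z, Integrable f ν ∧ ∀ A, MeasurableSet A → T (m A) = ∫ ω in A, f ω ∂ν := by
  have happrox : ∀ n : ℕ, ∃ (f : Ω → Z) (R : Set Ω), Integrable f ν ∧ MeasurableSet R ∧
      ν.real R < 1 / ((n : ℝ) + 1) ∧ ∀ A, MeasurableSet A →
        ‖T (m A) - ∫ ω in A, f ω ∂ν‖ ≤ 1 / ((n : ℝ) + 1) * ν.real A + ‖T‖ * ν.real (A ∩ R) :=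
    fun n => exists_integrable_approx m hm T Nat.one_div_pos_of_nat.le
      (h _ Nat.one_div_pos_of_nat) Nat.one_div_pos_of_nat
  choose f R hf hR hRν hfR using happrox
  set K := ν.real univ + ‖T‖ with hK
  have hK0 : 0 ≤ K := by positivity
  have hdiff : ∀ i j : ℕ, ∫ ω, ‖f i ω - f j ω‖ ∂ν ≤
      1 / ((i : ℝ) + 1) * K + 1 / ((j : ℝ) + 1) * K := by
    intro i j
    -- `ρ` is the sum of the two error bounds, read as measures. It dominates the integrals of `f i
    -- - f j`, so its total mass bounds their `L¹` distance.
    set ρ : Measure Ω := (1 / ((i : ℝ) + 1)).toNNReal • ν + ‖T‖.toNNReal • ν.restrict (R i) +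
      ((1 / ((j : ℝ) + 1)).toNNReal • ν + ‖T‖.toNNReal • ν.restrict (R j)) with hρ
    have hρA : ∀ A, MeasurableSet A → ρ.real A =
        1 / ((i : ℝ) + 1) * ν.real A + ‖T‖ * ν.real (A ∩ R i) +
        (1 / ((j : ℝ) + 1) * ν.real A + ‖T‖ * ν.real (A ∩ R j)) := by
      intro A hA
      have h1 : ∀ n : ℕ, max (1 / ((n : ℝ) + 1)) 0 = 1 / ((n : ℝ) + 1) := fun n =>
        max_eq_left Nat.one_div_pos_of_nat.le
      rw [hρ, measureReal_add_apply, measureReal_add_apply, measureReal_add_apply]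
      simp only [measureReal_nnreal_smul_apply, Real.coe_toNNReal', h1,
        max_eq_left (norm_nonneg T), measureReal_restrict_apply hA]
    have hle : ∀ n : ℕ, 1 / ((n : ℝ) + 1) * ν.real univ + ‖T‖ * ν.real (univ ∩ R n) ≤
        1 / ((n : ℝ) + 1) * K := by
      intro n
      have h2 := mul_le_mul_of_nonneg_left (hRν n).le (norm_nonneg T)
      rw [univ_inter, hK, mul_add]
      linarith
    calc ∫ ω, ‖f i ω - f j ω‖ ∂ν ≤ ρ.real univ := by
          refine integral_norm_le_of_norm_setIntegral_le ((hf i).sub (hf j)) fun A hA => ?_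
          rw [integral_sub (hf i).integrableOn (hf j).integrableOn, hρA A hA,
            ← sub_sub_sub_cancel_left _ _ (T (m A)), ← norm_neg, neg_sub]
          exact (norm_sub_le _ _).trans (add_le_add (hfR i A hA) (hfR j A hA))
      _ ≤ _ := by
          rw [hρA _ MeasurableSet.univ]
          exact add_le_add (hle i) (hle j)
  have hlim0 : Tendsto (fun n : ℕ => 1 / ((n : ℝ) + 1) * K) atTop (𝓝 0) := by
    simpa using tendsto_one_div_add_atTop_nhds_zero_nat.mul_const K
  have hdist : ∀ i j, dist ((hf i).toL1 (f i)) ((hf j).toL1 (f j)) =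
      ∫ ω, ‖f i ω - f j ω‖ ∂ν := by
    intro i j
    rw [dist_eq_norm, ← Integrable.toL1_sub, Integrable.norm_toL1_eq_lintegral_norm]
    have h1 := integral_norm_eq_lintegral_enorm ((hf i).sub (hf j)).1
    simp only [Pi.sub_apply] at h1
    rw [h1]
    simp [ofReal_norm]
  have hcau : CauchySeq fun n => (hf n).toL1 (f n) := by
    refine Metric.cauchySeq_iff'.2 fun ε hε => ?_
    obtain ⟨N, hN⟩ := eventually_atTop.1 (hlim0.eventually_lt_const (half_pos hε))
    refine ⟨N, fun n hn => ?_⟩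
    rw [hdist]
    linarith [hdiff n N, hN n hn, hN N le_rfl]
  obtain ⟨g, hg⟩ := cauchySeq_tendsto_of_complete hcau
  refine ⟨g, L1.integrable_coeFn g, fun A hA => ?_⟩
  have h1 : Tendsto (fun n => ∫ ω in A, f n ω ∂ν) atTop (𝓝 (∫ ω in A, g ω ∂ν)) := by
    have := ((continuous_setIntegral A).tendsto g).comp hg
    refine this.congr fun n => ?_
    exact integral_congr_ae (ae_restrict_of_ae (Integrable.coeFn_toL1 (hf n)))
  have h2 : Tendsto (fun n => ∫ ω in A, f n ω ∂ν) atTop (𝓝 (T (m A))) := by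
    rw [tendsto_iff_norm_sub_tendsto_zero]
    refine squeeze_zero (fun _ => norm_nonneg _) (fun n => ?_) hlim0
    rw [norm_sub_rev]
    refine (hfR n A hA).trans ?_
    have h3 : ν.real (A ∩ R n) ≤ 1 / ((n : ℝ) + 1) :=
      (measureReal_mono inter_subset_right).trans (hRν n).le
    have h4 := mul_le_mul_of_nonneg_left h3 (norm_nonneg T)
    have h5 : 1 / ((n : ℝ) + 1) * ν.real A ≤ 1 / ((n : ℝ) + 1) * ν.real univ := by
      gcongr
      exacts [measure_ne_top _ _, subset_univ A]
    rw [hK, mul_add]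
    linarith
  exact tendsto_nhds_unique h2 h1

end Averages

/-- An operator for which the subsets of the unit ball are f-dentable is a Radon–Nikodym
operator. -/
theorem isBanachRNOperator_of_forall_notMem_convexHull {X : Type u} {Z : Type v}
    [NormedAddCommGroup X] [NormedSpace ℝ X] [CompleteSpace X]
    [NormedAddCommGroup Z] [NormedSpace ℝ Z] [CompleteSpace Z] (T : X →L[ℝ] Z)
    (hT : ∀ S : Set X, S.Nonempty → S ⊆ Metric.closedBall 0 1 → ∀ ε : ℝ, 0 < ε →
      ∃ x ∈ S, x ∉ convexHull ℝ {y ∈ S | ε < ‖T y - T x‖}) :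
    IsBanachRNOperator.{w} T := by
  intro Ω _ μ _ m hfin hac
  -- Averages are taken with respect to the variation, since `‖m A‖ ≤ μ A` may fail; the density is
  -- carried back to `μ` by the scalar Radon–Nikodym derivative.
  set ν := m.variation with hν
  have : IsFiniteMeasure ν := ⟨lt_top_iff_ne_top.2 hfin⟩
  have hνμ : ν ≪ μ := by
    refine Measure.AbsolutelyContinuous.mk fun s hs hs0 => ?_
    rw [hν, VectorMeasure.variation_apply_eq_zero hs]
    intro t hts ht
    apply hac
    rw [Measure.toENNRealVectorMeasure_apply_measurable ht]
    exact measure_mono_null hts hs0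
  have hm : ∀ A, ‖m A‖ ≤ ν.real A := fun A =>
    VectorMeasure.norm_measure_le_variation (measure_ne_top ν A)
  obtain ⟨f, hf, hfA⟩ := exists_density_of_averages_close (ν := ν) m hm T
    fun ε hε A hA hA0 => exists_subset_averages_close m hm T hT hA hA0 hε
  refine ⟨fun ω => (ν.rnDeriv μ ω).toReal • f ω, ?_, fun A hA => ?_⟩
  · rw [← integrable_rnDeriv_smul_iff hνμ] at hf
    exact hf
  · rw [hfA A hA, setIntegral_rnDeriv_smul hνμ hA]

/-! ### Comparison of the three hulls -/

section Hulls

variable {E : Type*} [AddCommGroup E] [Module ℝ E] [TopologicalSpace E]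

/-- The partial sums, divided by their total weights, are convex combinations; the weights tend to
one, so the limit is unchanged. -/
theorem sConvexHull_subset_closure_convexHull [ContinuousSMul ℝ E] (A : Set E) :
    sConvexHull A ⊆ closure (convexHull ℝ A) := by
  rintro x ⟨a, y, ha, hy, hsum, hlim⟩
  have hs := hsum.tendsto_sum_nat
  have hlim' : Tendsto (fun n => (∑ i ∈ Finset.range n, a i)⁻¹ • ∑ i ∈ Finset.range n, a i • y i)
      atTop (𝓝 x) := by
    simpa using (hs.inv₀ one_ne_zero).smul hlim
  refine mem_closure_of_tendsto hlim' ?_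
  filter_upwards [hs.eventually_const_lt zero_lt_one] with n hn
  exact (Finset.range n).centerMass_mem_convexHull (fun i _ => ha i) hn fun i _ => hy i

theorem convexHull_subset_sConvexHull (A : Set E) : convexHull ℝ A ⊆ sConvexHull A := by
  intro x hx
  have hA : A.Nonempty := convexHull_nonempty_iff.1 ⟨x, hx⟩
  rw [convexHull_eq] at hx
  obtain ⟨ι, t, a, y, ha, hsum, hy, rfl⟩ := hx
  obtain ⟨y₀, hy₀⟩ := hA
  rw [Finset.centerMass_eq_of_sum_1 _ _ hsum]
  set e := t.equivFin
  set a' : ℕ → ℝ := fun n => if h : n < t.card then a (e.symm ⟨n, h⟩) else 0 with ha'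
  -- The default `y₀` keeps the padded points in `A`; they have weight zero.
  set y' : ℕ → E := fun n => if h : n < t.card then y (e.symm ⟨n, h⟩) else y₀ with hy'
  have hsum' : ∑ i ∈ Finset.range t.card, a' i = 1 := by
    rw [← hsum, Finset.sum_range, ← Finset.sum_coe_sort t, ← e.symm.sum_comp]
    simp [ha']
  have hsum'' : ∑ i ∈ Finset.range t.card, a' i • y' i = ∑ i ∈ t, a i • y i := by
    rw [Finset.sum_range, ← Finset.sum_coe_sort t, ← e.symm.sum_comp]
    simp [ha', hy']
  have h0 : ∀ n, n ∉ Finset.range t.card → a' n = 0 := fun n hn => by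
    rw [Finset.mem_range] at hn
    simp [ha', hn]
  refine ⟨a', y', fun n => ?_, fun n => ?_, ?_, ?_⟩
  · by_cases h : n < t.card
    · simpa [ha', h] using ha _ (e.symm ⟨n, h⟩).2
    · simp [ha', h]
  · by_cases h : n < t.card
    · simpa [hy', h] using hy _ (e.symm ⟨n, h⟩).2
    · simpa [hy', h] using hy₀
  · exact hsum' ▸ hasSum_sum_of_ne_finset_zero h0
  · refine tendsto_const_nhds.congr' ?_
    filter_upwards [eventually_ge_atTop t.card] with n hn
    rw [← hsum'', ← Finset.sum_subset (Finset.range_mono hn) fun i _ hi => by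
      rw [h0 i hi, zero_smul]]

theorem IsDentable.isSDentable [ContinuousSMul ℝ E] {B : Set E} (h : IsDentable B) :
    IsSDentable B := fun V hV hVc =>
  let ⟨x, hx, hx'⟩ := h V hV hVc
  ⟨x, hx, fun h' => hx' (sConvexHull_subset_closure_convexHull _ h')⟩

theorem IsSDentable.isFDentable {B : Set E} (h : IsSDentable B) : IsFDentable B := fun V hV hVc =>
  let ⟨x, hx, hx'⟩ := h V hV hVc
  ⟨x, hx, fun h' => hx' (convexHull_subset_sConvexHull _ h')⟩

end Hulls

/-! ### f-dentability implies the Radon–Nikodym property; examples of SBM-spaces -/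

section Spaces

variable {E : Type u} [AddCommGroup E] [Module ℝ E] [UniformSpace E] [IsUniformAddGroup E]
  [ContinuousSMul ℝ E] [T2Space E]

theorem CompleteDisk.incl_mem_smul_of_norm_lt (B : CompleteDisk E) {x : B.Space} {r : ℝ}
    (h : ‖x‖ < r) : B.incl x ∈ r • B.carrier :=
  B.mem_of_gaugeOn_lt h

/-- Convex hulls commute with the linear inclusion of `E_B`, and distances in the completion for `V`
are values of the Minkowski functional of `V`. Hence f-dentability of the image in `E` of a subset
of the unit ball is the hypothesis of the Banach space criterion. -/
theorem hasRNP_of_forall_isFDentable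
    (h : ∀ B : Set E, B.Nonempty → Bornology.IsVonNBounded ℝ B → IsFDentable B) :
    HasRNP.{w} E := by
  intro B V
  refine isBanachRNOperator_of_forall_notMem_convexHull _ fun S hS hS1 ε hε => ?_
  have hbdd : Bornology.IsVonNBounded ℝ (B.incl '' S) := by
    -- Norm at most one gives membership in `r B` only for `r > 1`; the choice is `r = 2`.
    have h2 : Bornology.IsVonNBounded ℝ ((2 : ℝ) • B.carrier) :=
      B.isBounded.image ((2 : ℝ) • ContinuousLinearMap.id ℝ E)
    refine h2.subset ?_
    rintro _ ⟨x, hx, rfl⟩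
    refine B.incl_mem_smul_of_norm_lt ((mem_closedBall_zero_iff.1 (hS1 hx)).trans_lt one_lt_two)
  have hnhd : V.gaugeOn.closedBall 0 ε ∈ 𝓝 (0 : E) := by
    filter_upwards [(tendsto_gauge_nhds_zero V.mem_nhds).eventually_lt_const hε] with x hx
    rw [Seminorm.mem_closedBall_zero]
    exact hx.le
  obtain ⟨_, ⟨x, hx, rfl⟩, hx'⟩ := h _ (hS.image B.incl) hbdd _ hnhd
    ⟨V.gaugeOn.balanced_closedBall_zero ε, V.gaugeOn.convex_closedBall 0 ε⟩
  refine ⟨x, hx, fun hmem => hx' ?_⟩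
  have himg : B.incl x ∈ B.inclₗ '' convexHull ℝ {y ∈ S | ε <
      ‖(V.toBanachSpace ∘L ContinuousLinearMap.id ℝ E ∘L B.incl) y -
        (V.toBanachSpace ∘L ContinuousLinearMap.id ℝ E ∘L B.incl) x‖} := ⟨x, hmem, rfl⟩
  rw [LinearMap.image_convexHull] at himg
  refine convexHull_mono ?_ himg
  rintro _ ⟨y, ⟨hy, hyε⟩, rfl⟩
  refine ⟨⟨y, hy, rfl⟩, fun hmem' => hyε.not_ge ?_⟩
  rw [← map_sub]
  change ‖V.toBanachSpace (B.incl (y - x))‖ ≤ ε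
  rw [V.norm_toBanachSpace, map_sub]
  rw [mem_preimage, mem_vadd_set_iff_neg_vadd_mem, Seminorm.mem_closedBall_zero, vadd_eq_add,
    neg_add_eq_sub] at hmem'
  exact hmem'

theorem isSBMSpace_of_quasiComplete [QuasiCompleteSpace ℝ E] (h : HasMetrizableBoundedSets E) :
    IsSBMSpace E where
  seqComplete S hS hSb _ x hx hcau :=
    cauchySeq_tendsto_of_isComplete (QuasiCompleteSpace.quasiComplete hSb hS) hx hcau
  exists_seq M hM x hx := by
    -- The closure of `M` is again bounded, hence metrizable, so sequences describe closures inside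
    -- it.
    have := h _ (hM.closure)
    set x' : closure M := ⟨x, hx⟩
    have hx' : x' ∈ closure ((↑) ⁻¹' M : Set (closure M)) := by
      rw [closure_subtype, Subtype.image_preimage_coe, inter_eq_right.2 subset_closure]
      exact hx
    obtain ⟨y, hy, hlim⟩ := mem_closure_iff_seq_limit.1 hx'
    exact ⟨fun n => y n, hy, (continuous_subtype_val.tendsto x').comp hlim⟩
  metrizable S hS _ := h S hS

theorem IsFrechetSpace.isSBMSpace (h : IsFrechetSpace E) : IsSBMSpace E := by
  obtain ⟨-, _, _⟩ := h
  exact isSBMSpace_of_quasiComplete fun S _ => inferInstance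

end Spaces

/-! ### Markov chains with summable drift -/

section MarkovChain

open ProbabilityTheory Preorder

variable {S : Type*} [Countable S] [MeasurableSpace S] [DiscreteMeasurableSpace S]

/-- The kernel on paths `(x₀, …, xₙ)` which depends on the last state `xₙ` only. -/
noncomputable def lastStateKernel (n : ℕ) (q : S → Measure S) : Kernel (Finset.Iic n → S) S where
  toFun x := q (x ⟨n, Finset.mem_Iic.2 le_rfl⟩)
  measurable' := measurable_of_countable _

instance (n : ℕ) (q : S → Measure S) [∀ s, IsProbabilityMeasure (q s)] :
    IsMarkovKernel (lastStateKernel n q) :=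
  ⟨fun x => inferInstanceAs (IsProbabilityMeasure (q (x ⟨n, _⟩)))⟩

/-- `μ` is the law of a Markov chain with transition probabilities `q n` from time `n`. -/
def IsMarkovChainLaw (q : ℕ → S → Measure S) (μ : Measure (ℕ → S)) : Prop :=
  ∀ n, μ.map (frestrictLe (π := fun _ => S) n) ⊗ₘ lastStateKernel n (q n) =
    μ.map fun x => (frestrictLe (π := fun _ => S) n x, x (n + 1))

/-- This is the Ionescu-Tulcea construction. Only the transitions matter, so the initial state is
arbitrary. -/
theorem exists_isMarkovChainLaw [Nonempty S] (q : ℕ → S → Measure S)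
    [∀ n s, IsProbabilityMeasure (q n s)] :
    ∃ μ : Measure (ℕ → S), IsProbabilityMeasure μ ∧ IsMarkovChainLaw q μ :=
  ⟨Kernel.trajMeasure (X := fun _ => S) (Measure.dirac (Classical.arbitrary S))
    fun n => lastStateKernel n (q n), inferInstance,
    fun _ => Kernel.map_frestrictLe_trajMeasure_compProd_eq_map_trajMeasure⟩

variable {q : ℕ → S → Measure S} {μ : Measure (ℕ → S)}

theorem IsMarkovChainLaw.ae_transition (hμ : IsMarkovChainLaw q μ) {n : ℕ} {J : S → S → Prop}
    (hJ : ∀ s, ∀ᵐ t ∂q n s, J s t) : ∀ᵐ ω ∂μ, J (ω n) (ω (n + 1)) := by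
  have h1 : ∀ᵐ p ∂(μ.map (frestrictLe (π := fun _ => S) n) ⊗ₘ lastStateKernel n (q n)),
      J (p.1 ⟨n, Finset.mem_Iic.2 le_rfl⟩) p.2 :=
    Measure.ae_compProd_of_ae_ae (MeasurableSet.of_discrete) (ae_of_all _ fun x => hJ _)
  rw [hμ n, ae_map_iff (by fun_prop) (MeasurableSet.of_discrete)] at h1
  exact h1

variable [IsProbabilityMeasure μ] {Z : Type*} [NormedAddCommGroup Z]

theorem integrable_comp_eval {β : S → Z} {M : ℝ} (hβ : ∀ s, ‖β s‖ ≤ M) (n : ℕ) :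
    Integrable (fun ω : ℕ → S => β (ω n)) μ :=
  .of_bound ((StronglyMeasurable.of_discrete (f := β)).comp_measurable
    (measurable_pi_apply n)).aestronglyMeasurable M (ae_of_all _ fun _ => hβ _)

variable [∀ n s, IsProbabilityMeasure (q n s)] [NormedSpace ℝ Z]

/-- One step of the chain changes integrals against functions of the past by at most the
drift. -/
theorem IsMarkovChainLaw.norm_integral_smul_sub_le [CompleteSpace Z]
    (hμ : IsMarkovChainLaw q μ) {β : S → Z} {M : ℝ} (hβ : ∀ s, ‖β s‖ ≤ M) {n : ℕ} {ε : ℝ}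
    (hε : ∀ s, ‖∫ t, β t ∂q n s - β s‖ ≤ ε)
    {g : (Finset.Iic n → S) → ℝ} {C : ℝ} (hg : ∀ x, ‖g x‖ ≤ C) :
    ‖∫ ω, g (frestrictLe (π := fun _ => S) n ω) • (β (ω (n + 1)) - β (ω n)) ∂μ‖ ≤
      ε * ∫ ω, ‖g (frestrictLe (π := fun _ => S) n ω)‖ ∂μ := by
  set μn := μ.map (frestrictLe (π := fun _ => S) n) with hμn
  have hmeas : Measurable (frestrictLe (π := fun _ : ℕ => S) n) := by fun_prop
  have : IsProbabilityMeasure μn := Measure.isProbabilityMeasure_map hmeas.aemeasurable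
  set last : Finset.Iic n := ⟨n, Finset.mem_Iic.2 le_rfl⟩
  set G : (Finset.Iic n → S) × S → Z := fun p => g p.1 • (β p.2 - β (p.1 last)) with hG
  have hGint : Integrable G (μn ⊗ₘ lastStateKernel n (q n)) := by
    refine .of_bound (StronglyMeasurable.of_discrete).aestronglyMeasurable (C * (M + M))
      (ae_of_all _ fun p => ?_)
    rw [hG, norm_smul]
    exact mul_le_mul (hg _) ((norm_sub_le _ _).trans (add_le_add (hβ _) (hβ _))) (norm_nonneg _)
      ((norm_nonneg _).trans (hg p.1))
  have h1 : ∫ ω, g (frestrictLe (π := fun _ => S) n ω) • (β (ω (n + 1)) - β (ω n)) ∂μ =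
      ∫ p, G p ∂(μn ⊗ₘ lastStateKernel n (q n)) := by
    rw [hμn, hμ n, integral_map (by fun_prop)
      (StronglyMeasurable.of_discrete).aestronglyMeasurable]
    rfl
  have hβint : ∀ s, Integrable β (q n s) := fun s =>
    .of_bound (StronglyMeasurable.of_discrete).aestronglyMeasurable M (ae_of_all _ hβ)
  rw [h1, Measure.integral_compProd hGint]
  -- Given the path up to time `n`, the weight `g` is constant and the mean increment is the drift
  -- at the last state.
  have h2 : ∀ x : Finset.Iic n → S, ∫ t, G (x, t) ∂(lastStateKernel n (q n) x) =
      g x • (∫ t, β t ∂q n (x last) - β (x last)) := by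
    intro x
    change ∫ t, g x • (β t - β (x last)) ∂(q n (x last)) = _
    rw [integral_smul, integral_sub (hβint _) (integrable_const _), integral_const]
    simp
  simp_rw [h2]
  rw [← integral_map (φ := frestrictLe (π := fun _ => S) n) (f := fun x => ‖g x‖)
    hmeas.aemeasurable (StronglyMeasurable.of_discrete).aestronglyMeasurable, ← integral_const_mul]
  refine norm_integral_le_of_norm_le (g := fun x => ε * ‖g x‖) ?_ (ae_of_all _ fun x => ?_)
  · refine (Integrable.of_bound (StronglyMeasurable.of_discrete).aestronglyMeasurable C
      (ae_of_all _ fun x => ?_)).const_mul ε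
    rw [norm_norm]
    exact hg x
  · rw [norm_smul, mul_comm]
    gcongr
    exact hε _

/-- Integrable functions on the path space are limits in `L¹` of bounded functions of finitely
many coordinates. -/
theorem exists_tendsto_integral_norm_sub_frestrictLe [Nonempty S] {f : (ℕ → S) → Z}
    (hf : Integrable f μ) {δ : ℝ} (hδ : 0 < δ) :
    ∀ᶠ n in atTop, ∃ g : (Finset.Iic n → S) → Z, (∃ C, ∀ x, ‖g x‖ ≤ C) ∧
      ∫ ω, ‖f ω - g (frestrictLe (π := fun _ => S) n ω)‖ ∂μ < δ := by
  classical
  let _ : TopologicalSpace S := ⊥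
  have : DiscreteTopology S := ⟨rfl⟩
  obtain ⟨G, hG, hGint⟩ := hf.exists_boundedContinuous_integral_sub_le (half_pos hδ)
  obtain ⟨s₀⟩ := ‹Nonempty S›
  -- `e n` extends a finite path by the constant `s₀`. The extended truncations of `ω` converge to
  -- `ω`, so continuity of `G` and dominated convergence apply.
  set e : ∀ n : ℕ, (Finset.Iic n → S) → ℕ → S := fun n x i =>
    if h : i ∈ Finset.Iic n then x ⟨i, h⟩ else s₀ with he
  have hlim : ∀ ω : ℕ → S, Tendsto (fun n => e n (frestrictLe (π := fun _ => S) n ω)) atTop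
      (𝓝 ω) := by
    intro ω
    rw [tendsto_pi_nhds]
    intro i
    refine tendsto_const_nhds.congr' ?_
    filter_upwards [eventually_ge_atTop i] with n hn
    simp [he, hn]
  have hGsm : ∀ n, StronglyMeasurable fun ω => G (e n (frestrictLe (π := fun _ => S) n ω)) :=
    fun n => (StronglyMeasurable.of_discrete (f := fun x => G (e n x))).comp_measurable
      (by fun_prop)
  have hGn : ∀ n, Integrable (fun ω => G (e n (frestrictLe (π := fun _ => S) n ω))) μ := fun n =>
    .of_bound (hGsm n).aestronglyMeasurable ‖G‖ (ae_of_all _ fun ω => G.norm_coe_le_norm _)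
  have h0 : Tendsto (fun n => ∫ ω, ‖G ω - G (e n (frestrictLe (π := fun _ => S) n ω))‖ ∂μ) atTop
      (𝓝 0) := by
    rw [← integral_zero (ℕ → S) ℝ (μ := μ)]
    refine tendsto_integral_of_dominated_convergence (fun _ => ‖G‖ + ‖G‖)
      (fun n => (hGint.1.sub (hGn n).1).norm) (integrable_const _)
      (fun n => ae_of_all _ fun ω => ?_) (ae_of_all _ fun ω => ?_)
    · rw [norm_norm]
      exact (norm_sub_le _ _).trans (add_le_add (G.norm_coe_le_norm _) (G.norm_coe_le_norm _))
    · have := ((G.continuous.tendsto ω).comp (hlim ω)).const_sub (G ω)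
      simpa using this.norm
  filter_upwards [h0.eventually_lt_const (half_pos hδ)] with n hn
  refine ⟨fun x => G (e n x), ⟨‖G‖, fun x => G.norm_coe_le_norm _⟩, ?_⟩
  calc ∫ ω, ‖f ω - G (e n (frestrictLe (π := fun _ => S) n ω))‖ ∂μ
      ≤ ∫ ω, (‖f ω - G ω‖ + ‖G ω - G (e n (frestrictLe (π := fun _ => S) n ω))‖) ∂μ :=
        integral_mono (hf.sub (hGn n)).norm ((hf.sub hGint).norm.add (hGint.sub (hGn n)).norm)
          fun ω => norm_sub_le_norm_sub_add_norm_sub _ _ _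
    _ = ∫ ω, ‖f ω - G ω‖ ∂μ + ∫ ω, ‖G ω - G (e n (frestrictLe (π := fun _ => S) n ω))‖ ∂μ :=
        integral_add (hf.sub hGint).norm (hGint.sub (hGn n)).norm
    _ < δ := by linarith

/-- For a chain with summable drift, the integrals over a fixed event form a Cauchy sequence. -/
theorem IsMarkovChainLaw.cauchySeq_setIntegral [Nonempty S] [CompleteSpace Z]
    (hμ : IsMarkovChainLaw q μ)
    {β : S → Z} {M : ℝ} (hβ : ∀ s, ‖β s‖ ≤ M)
    (hε : ∀ᶠ n in atTop, ∀ s, ‖∫ t, β t ∂q n s - β s‖ ≤ (1 / 2) ^ n)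
    {A : Set (ℕ → S)} (hA : MeasurableSet A) :
    CauchySeq fun n => ∫ ω in A, β (ω n) ∂μ := by
  have hM : 0 ≤ M := (norm_nonneg _).trans (hβ (Classical.arbitrary S))
  rw [Metric.cauchySeq_iff']
  intro δ hδ
  -- Replacing the indicator of `A` by a function of finitely many coordinates costs at most `M * η
  -- ≤ δ / 4`, uniformly in time; `M + 1` avoids division by zero.
  set η := δ / (4 * (M + 1)) with hη
  have hη0 : 0 < η := by positivity
  have hηM : M * η ≤ δ / 4 := by
    rw [hη, mul_div_assoc', div_le_div_iff₀ (by positivity) (by positivity)]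
    nlinarith
  have hAint : Integrable (A.indicator fun _ => (1 : ℝ)) μ := (integrable_const _).indicator hA
  obtain ⟨k, ⟨g, ⟨C, hC⟩, hg⟩, hk⟩ :=
    ((exists_tendsto_integral_norm_sub_frestrictLe hAint hη0).and
      (eventually_forall_ge_atTop.2 hε)).exists
  set G : (ℕ → S) → ℝ := fun ω => g (frestrictLe (π := fun _ => S) k ω) with hG
  have hGsm : StronglyMeasurable G :=
    (StronglyMeasurable.of_discrete (f := g)).comp_measurable (by fun_prop)
  have hGint : Integrable G μ :=
    .of_bound hGsm.aestronglyMeasurable C (ae_of_all _ fun ω => hC _)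
  have hβn := fun n => integrable_comp_eval (μ := μ) hβ n
  have hGβ : ∀ n, Integrable (fun ω => G ω • β (ω n)) μ := fun n =>
    (hβn n).bdd_smul C hGsm.aestronglyMeasurable (ae_of_all _ fun ω => hC _)
  have happ : ∀ n, dist (∫ ω in A, β (ω n) ∂μ) (∫ ω, G ω • β (ω n) ∂μ) ≤ δ / 4 := by
    intro n
    have h1 : ∫ ω in A, β (ω n) ∂μ = ∫ ω, A.indicator (fun _ => (1 : ℝ)) ω • β (ω n) ∂μ := by
      rw [← integral_indicator hA]
      refine integral_congr_ae (ae_of_all _ fun ω => ?_)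
      by_cases h : ω ∈ A <;> simp [h]
    have hAβ : Integrable (fun ω => A.indicator (fun _ => (1 : ℝ)) ω • β (ω n)) μ := by
      refine ((hβn n).indicator hA).congr (ae_of_all _ fun ω => ?_)
      by_cases h : ω ∈ A <;> simp [h]
    rw [dist_eq_norm, h1, ← integral_sub hAβ (hGβ n)]
    refine (norm_integral_le_of_norm_le
      (g := fun ω => M * ‖A.indicator (fun _ => (1 : ℝ)) ω - G ω‖)
      ((hAint.sub hGint).norm.const_mul M) (ae_of_all _ fun ω => ?_)).trans ?_
    · rw [← sub_smul, norm_smul, mul_comm]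
      gcongr
      exact hβ _
    · rw [integral_const_mul]
      exact (mul_le_mul_of_nonneg_left hg.le hM).trans hηM
  -- From time `k` on, `G` depends on the past only and the drift is at most `2⁻ⁿ`, so the
  -- increments are dominated by a geometric series.
  have hcau : CauchySeq fun n => ∫ ω, G ω • β (ω (n + k)) ∂μ := by
    refine cauchySeq_of_le_geometric (1 / 2) (∫ ω, ‖G ω‖ ∂μ) (by norm_num) fun n => ?_
    rw [dist_comm, dist_eq_norm, ← integral_sub (hGβ _) (hGβ _)]
    simp_rw [← smul_sub]
    have hkn : k ≤ n + k := Nat.le_add_left _ _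
    have := hμ.norm_integral_smul_sub_le hβ (hk (n + k) hkn)
      (g := fun x => g (frestrictLe₂ (π := fun _ => S) hkn x)) (fun x => hC _)
    rw [add_right_comm]
    refine this.trans ?_
    rw [mul_comm]
    refine mul_le_mul_of_nonneg_left ?_ (integral_nonneg fun _ => norm_nonneg _)
    exact pow_le_pow_of_le_one (by norm_num) (by norm_num) (Nat.le_add_right _ _)
  obtain ⟨N, hN⟩ := Metric.cauchySeq_iff'.1 hcau (δ / 2) (half_pos hδ)
  refine ⟨N + k, fun n hn => ?_⟩
  obtain ⟨j, rfl⟩ := Nat.exists_eq_add_of_le' ((Nat.le_add_left k N).trans hn)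
  calc _ ≤ _ := dist_triangle4 _ (∫ ω, G ω • β (ω (j + k)) ∂μ) (∫ ω, G ω • β (ω (N + k)) ∂μ) _
    _ < δ / 4 + δ / 2 + δ / 4 := by
        have := hN j (by omega)
        have h2 := happ (N + k)
        rw [dist_comm] at h2
        linarith [happ (j + k)]
    _ = δ := by ring

/-- For a chain with summable drift, the integrals over an event determined by the first `n`
steps hardly change after time `n`. -/
theorem IsMarkovChainLaw.norm_setIntegral_sub_le [CompleteSpace Z] (hμ : IsMarkovChainLaw q μ)
    {β : S → Z} {M : ℝ} (hβ : ∀ s, ‖β s‖ ≤ M) {n : ℕ}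
    (hε : ∀ i, n ≤ i → ∀ s, ‖∫ t, β t ∂q i s - β s‖ ≤ (1 / 2) ^ i)
    (D : Set (Finset.Iic n → S)) {L : Z}
    (hL : Tendsto (fun i => ∫ ω in frestrictLe (π := fun _ => S) n ⁻¹' D, β (ω i) ∂μ) atTop
      (𝓝 L)) :
    ‖∫ ω in frestrictLe (π := fun _ => S) n ⁻¹' D, β (ω n) ∂μ - L‖ ≤
      2 * (1 / 2) ^ n * μ.real (frestrictLe (π := fun _ => S) n ⁻¹' D) := by
  classical
  set A := frestrictLe (π := fun _ => S) n ⁻¹' D with hAdef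
  have hA : MeasurableSet A :=
    (show Measurable (frestrictLe (π := fun _ : ℕ => S) n) by fun_prop) MeasurableSet.of_discrete
  have hβn := fun n => integrable_comp_eval (μ := μ) hβ n
  -- The event is determined by time `n`, so later steps contribute a geometric series with first
  -- term `2⁻ⁿ μ(A)`; its sum explains the factor two.
  have hstep : ∀ j, dist (∫ ω in A, β (ω (n + j)) ∂μ) (∫ ω in A, β (ω (n + (j + 1))) ∂μ) ≤
      (1 / 2) ^ n * μ.real A * (1 / 2) ^ j := by
    intro j
    have hnj : n ≤ n + j := Nat.le_add_right _ _
    have := hμ.norm_integral_smul_sub_le hβ (hε (n + j) hnj)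
      (g := fun x => D.indicator (fun _ => (1 : ℝ)) (frestrictLe₂ (π := fun _ => S) hnj x)) (C := 1)
      (fun x => by
        by_cases h : frestrictLe₂ (π := fun _ => S) hnj x ∈ D <;> simp [h])
    have h1 : ∀ ω : ℕ → S, D.indicator (fun _ => (1 : ℝ))
        (frestrictLe₂ (π := fun _ => S) hnj (frestrictLe (π := fun _ => S) (n + j) ω)) =
        A.indicator (fun _ => (1 : ℝ)) ω := fun ω => rfl
    have h2 : ∫ ω, ‖A.indicator (fun _ => (1 : ℝ)) ω‖ ∂μ = μ.real A := by
      simp_rw [norm_indicator_eq_indicator_norm]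
      rw [integral_indicator hA]
      simp
    have h3 : ∫ ω, A.indicator (fun _ => (1 : ℝ)) ω • (β (ω (n + j + 1)) - β (ω (n + j))) ∂μ =
        ∫ ω in A, β (ω (n + (j + 1))) ∂μ - ∫ ω in A, β (ω (n + j)) ∂μ := by
      rw [← integral_sub (hβn _).integrableOn (hβn _).integrableOn, ← integral_indicator hA]
      refine integral_congr_ae (ae_of_all _ fun ω => ?_)
      by_cases h : ω ∈ A <;> simp [h, add_assoc]
    simp_rw [h1] at this
    rw [h2, h3] at this
    rw [dist_comm, dist_eq_norm]
    refine this.trans_eq ?_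
    rw [pow_add]
    ring
  have := dist_le_of_le_geometric_of_tendsto₀ (1 / 2) _ (by norm_num) hstep
    ((tendsto_add_atTop_iff_nat n).2 hL |>.congr fun j => by rw [add_comm])
  rw [dist_eq_norm] at this
  refine this.trans_eq ?_
  ring

/-- If the limits of the integrals of a chain with summable drift have a density, then the chain
converges to this density in `L¹`. -/
theorem IsMarkovChainLaw.tendsto_integral_norm_sub [Nonempty S] [CompleteSpace Z]
    (hμ : IsMarkovChainLaw q μ)
    {β : S → Z} {M : ℝ} (hβ : ∀ s, ‖β s‖ ≤ M)
    (hε : ∀ᶠ n in atTop, ∀ s, ‖∫ t, β t ∂q n s - β s‖ ≤ (1 / 2) ^ n)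
    {f : (ℕ → S) → Z} (hf : Integrable f μ)
    (hlim : ∀ A, MeasurableSet A →
      Tendsto (fun n => ∫ ω in A, β (ω n) ∂μ) atTop (𝓝 (∫ ω in A, f ω ∂μ))) :
    Tendsto (fun n => ∫ ω, ‖β (ω n) - f ω‖ ∂μ) atTop (𝓝 0) := by
  have hβn := fun n => integrable_comp_eval (μ := μ) hβ n
  rw [Metric.tendsto_nhds]
  intro δ hδ
  have hpow : Tendsto (fun n : ℕ => 2 * (1 / 2 : ℝ) ^ n) atTop (𝓝 0) := by
    simpa using (tendsto_pow_atTop_nhds_zero_of_lt_one (r := (1 / 2 : ℝ))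
      (by norm_num) (by norm_num)).const_mul 2
  filter_upwards [eventually_forall_ge_atTop.2 hε, hpow.eventually_lt_const (half_pos hδ),
    exists_tendsto_integral_norm_sub_frestrictLe hf (δ := δ / 4) (by positivity)]
    with n hn hn2 hn3
  obtain ⟨g, ⟨C, hC⟩, hg⟩ := hn3
  have hmeas : Measurable (frestrictLe (π := fun _ : ℕ => S) n) := by fun_prop
  set last : Finset.Iic n := ⟨n, Finset.mem_Iic.2 le_rfl⟩
  set G : (ℕ → S) → Z := fun ω => g (frestrictLe (π := fun _ => S) n ω) with hG
  have hGint : Integrable G μ :=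
    .of_bound ((StronglyMeasurable.of_discrete (f := g)).comp_measurable
      hmeas).aestronglyMeasurable C (ae_of_all _ fun ω => hC _)
  have hfG : Integrable (fun ω => ‖f ω - G ω‖) μ := (hf.sub hGint).norm
  set θ : Measure (ℕ → S) := μ.withDensity fun ω => ENNReal.ofReal ‖f ω - G ω‖ with hθ
  have : IsFiniteMeasure θ := isFiniteMeasure_withDensity_ofReal hfG.2
  have hθA : ∀ A, MeasurableSet A → θ.real A = ∫ ω in A, ‖f ω - G ω‖ ∂μ := by
    intro A hA
    rw [measureReal_def, hθ, withDensity_apply _ hA,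
      integral_eq_lintegral_of_nonneg_ae (ae_of_all _ fun ω => norm_nonneg _) hfG.1.restrict]
  set μn := μ.map (frestrictLe (π := fun _ => S) n) with hμn
  have : IsProbabilityMeasure μn := Measure.isProbabilityMeasure_map hmeas.aemeasurable
  -- The difference of `β (ω n)` and `G` is a function of the path up to time `n`. Its integral over
  -- an event of that time is bounded by the remaining drift plus the error of `G`, that is by `ρ`.
  -- Thus setwise estimates become an `L¹` estimate, and in total `δ / 2 + 2 · δ / 4 = δ`.
  set ρ : Measure (Finset.Iic n → S) := (2 * (1 / 2 : NNReal) ^ n) • μn +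
    θ.map (frestrictLe (π := fun _ => S) n) with hρ
  have hρD : ∀ D : Set (Finset.Iic n → S), ρ.real D =
      2 * (1 / 2) ^ n * μ.real (frestrictLe (π := fun _ => S) n ⁻¹' D) +
        ∫ ω in frestrictLe (π := fun _ => S) n ⁻¹' D, ‖f ω - G ω‖ ∂μ := by
    intro D
    rw [hρ, measureReal_add_apply, measureReal_nnreal_smul_apply, hμn,
      map_measureReal_apply hmeas .of_discrete, map_measureReal_apply hmeas .of_discrete,
      hθA _ (hmeas .of_discrete)]
    simp
  have hint : Integrable (fun x : Finset.Iic n → S => β (x last) - g x) μn :=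
    .of_bound (StronglyMeasurable.of_discrete).aestronglyMeasurable (M + C)
      (ae_of_all _ fun x => (norm_sub_le _ _).trans (add_le_add (hβ _) (hC _)))
  have hmain := integral_norm_le_of_norm_setIntegral_le (ρ := ρ) hint (fun D _ => by
    rw [hμn, setIntegral_map .of_discrete (StronglyMeasurable.of_discrete).aestronglyMeasurable
      hmeas.aemeasurable, hρD]
    change ‖∫ ω in frestrictLe (π := fun _ => S) n ⁻¹' D, (β (ω n) - G ω) ∂μ‖ ≤ _
    have hA := hlim _ (hmeas (MeasurableSet.of_discrete (s := D)))
    have h1 := hμ.norm_setIntegral_sub_le hβ hn D hA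
    have h2 : ∫ ω in frestrictLe (π := fun _ => S) n ⁻¹' D, (β (ω n) - G ω) ∂μ =
        (∫ ω in frestrictLe (π := fun _ => S) n ⁻¹' D, β (ω n) ∂μ -
          ∫ ω in frestrictLe (π := fun _ => S) n ⁻¹' D, f ω ∂μ) +
        ∫ ω in frestrictLe (π := fun _ => S) n ⁻¹' D, (f ω - G ω) ∂μ := by
      rw [integral_sub (hβn n).integrableOn hGint.integrableOn,
        integral_sub hf.integrableOn hGint.integrableOn]
      abel
    rw [h2]
    exact (norm_add_le _ _).trans (add_le_add h1 (norm_integral_le_integral_norm _)))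
  rw [hρD, preimage_univ, Measure.restrict_univ, probReal_univ, mul_one, hμn,
    integral_map hmeas.aemeasurable (StronglyMeasurable.of_discrete).aestronglyMeasurable] at hmain
  rw [dist_zero_right, Real.norm_of_nonneg (integral_nonneg fun _ => norm_nonneg _)]
  have hlast : ∫ ω, ‖β (ω n) - f ω‖ ∂μ ≤
      ∫ ω, ‖β (ω n) - G ω‖ ∂μ + ∫ ω, ‖f ω - G ω‖ ∂μ := by
    have hβG : Integrable (fun ω => ‖β (ω n) - G ω‖) μ := ((hβn n).sub hGint).norm
    rw [← integral_add hβG hfG]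
    refine integral_mono ((hβn n).sub hf).norm (hβG.add hfG) fun ω => ?_
    have := norm_sub_le_norm_sub_add_norm_sub (β (ω n)) (G ω) (f ω)
    rwa [norm_sub_rev (G ω) (f ω)] at this
  have hmain' : ∫ ω, ‖β (ω n) - G ω‖ ∂μ ≤ 2 * (1 / 2) ^ n + ∫ ω, ‖f ω - G ω‖ ∂μ := hmain
  linarith

/-- A chain with summable drift whose steps have length at least one has no limit density. -/
theorem IsMarkovChainLaw.not_exists_density [Nonempty S] [CompleteSpace Z]
    (hμ : IsMarkovChainLaw q μ)
    {β : S → Z} {M : ℝ} (hβ : ∀ s, ‖β s‖ ≤ M)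
    (hε : ∀ᶠ n in atTop, ∀ s, ‖∫ t, β t ∂q n s - β s‖ ≤ (1 / 2) ^ n)
    (hjump : ∀ n s, ∀ᵐ t ∂q n s, 1 ≤ ‖β t - β s‖)
    {f : (ℕ → S) → Z} (hf : Integrable f μ)
    (hlim : ∀ A, MeasurableSet A →
      Tendsto (fun n => ∫ ω in A, β (ω n) ∂μ) atTop (𝓝 (∫ ω in A, f ω ∂μ))) : False := by
  have hβn := fun n => integrable_comp_eval (μ := μ) hβ n
  have h0 := hμ.tendsto_integral_norm_sub hβ hε hf hlim
  -- Consecutive states are almost surely at distance at least one, yet both would be close to `f`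
  -- in `L¹`.
  have h1 := (h0.comp (tendsto_add_atTop_nat 1)).add h0
  rw [add_zero] at h1
  refine absurd (ge_of_tendsto h1 (Eventually.of_forall fun n => ?_)) (not_le.2 one_pos)
  have h2 : Integrable (fun ω => ‖β (ω (n + 1)) - f ω‖) μ := ((hβn (n + 1)).sub hf).norm
  have h3 : Integrable (fun ω => ‖β (ω n) - f ω‖) μ := ((hβn n).sub hf).norm
  change 1 ≤ ∫ ω, ‖β (ω (n + 1)) - f ω‖ ∂μ + ∫ ω, ‖β (ω n) - f ω‖ ∂μ
  rw [← integral_add h2 h3]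
  calc (1 : ℝ) = ∫ _, 1 ∂μ := by simp
    _ ≤ _ := by
      refine integral_mono_ae (integrable_const _) (h2.add h3) ?_
      filter_upwards [hμ.ae_transition (hjump n)] with ω hω
      have := norm_sub_le_norm_sub_add_norm_sub (β (ω (n + 1))) (f ω) (β (ω n))
      rw [norm_sub_rev (f ω)] at this
      exact hω.trans this

end MarkovChain

/-! ### Separability and boundedness of hulls -/

section Separability

variable {E : Type*} [AddCommGroup E] [Module ℝ E] [TopologicalSpace E] [ContinuousAdd E]
  [ContinuousSMul ℝ E]

/-- The hull is a continuous image of a standard simplex, which is separable. -/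
theorem Set.Finite.exists_countable_dense_convexHull {s : Set E} (hs : s.Finite) :
    ∃ c ⊆ convexHull ℝ s, c.Countable ∧ convexHull ℝ s ⊆ closure c := by
  let _ := hs.fintype
  rw [hs.convexHull_eq_image]
  set L : (s → ℝ) →ₗ[ℝ] E := ∑ x : s, (LinearMap.proj (R := ℝ) x).smulRight x.1 with hL
  change ∃ c ⊆ L '' stdSimplex ℝ s, c.Countable ∧ L '' stdSimplex ℝ s ⊆ closure c
  have hcont : Continuous L := by
    have : (L : (s → ℝ) → E) = fun f => ∑ x : s, f x • (x : E) := by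
      ext f
      simp [hL]
    rw [this]
    fun_prop
  obtain ⟨c, hc, hcs⟩ :=
    (TopologicalSpace.IsSeparable.of_separableSpace (stdSimplex ℝ s)).exists_countable_dense_subset
  exact ⟨L '' c, image_mono hc, hcs.1.image L,
    (image_mono hcs.2).trans (image_closure_subset_closure_image hcont)⟩

theorem Set.Countable.exists_countable_dense_convexHull {s : Set E} (hs : s.Countable) :
    ∃ c ⊆ convexHull ℝ s, c.Countable ∧ convexHull ℝ s ⊆ closure c := by
  choose! c hc hcount hdense using fun t : Finset E =>
    t.finite_toSet.exists_countable_dense_convexHull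
  have hT : {t : Finset E | (t : Set E) ⊆ s}.Countable := by
    have h := (countable_ofPred_finite_subset hs).preimage
      (SetLike.coe_injective : Function.Injective ((↑) : Finset E → Set E))
    exact h.mono fun t ht => show (t : Set E).Finite ∧ (t : Set E) ⊆ s from ⟨t.finite_toSet, ht⟩
  refine ⟨⋃ t ∈ {t : Finset E | (t : Set E) ⊆ s}, c t,
    iUnion₂_subset fun t ht => (hc t).trans (convexHull_mono ht),
    hT.biUnion fun t _ => hcount t, ?_⟩
  rw [convexHull_eq_union_convexHull_finite_subsets]
  exact iUnion₂_subset fun t ht => (hdense t).trans (closure_mono (subset_biUnion_of_mem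
    (u := fun t => c t) ht))

/-- Over the reals the absolutely convex hull is the convex hull of `s ∪ -s`. -/
theorem Set.Countable.separableSpace_closure_absConvexHull {s : Set E} (hs : s.Countable) :
    TopologicalSpace.SeparableSpace (closure (absConvexHull ℝ s)) := by
  obtain ⟨c, hc, hcount, hdense⟩ :=
    (hs.union (Set.neg_preimage (s := s) ▸
      hs.preimage neg_injective)).exists_countable_dense_convexHull
  rw [convexHull_union_neg_eq_absConvexHull] at hc hdense
  refine ⟨(↑) ⁻¹' c, hcount.preimage Subtype.val_injective, fun x => ?_⟩
  rw [closure_subtype, Subtype.image_preimage_coe,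
    inter_eq_right.2 (hc.trans subset_closure)]
  exact closure_minimal hdense isClosed_closure x.2

end Separability

section Bounded

variable {E : Type*} [AddCommGroup E] [Module ℝ E] [TopologicalSpace E] [ContinuousSMul ℝ E]
  [LocallyConvexSpace ℝ E]

theorem Bornology.IsVonNBounded.absConvexHull {s : Set E} (hs : Bornology.IsVonNBounded ℝ s) :
    Bornology.IsVonNBounded ℝ (absConvexHull ℝ s) := by
  rw [(nhds_hasBasis_absConvex ℝ E).isVonNBounded_iff]
  rintro V ⟨hV, hVc⟩
  obtain ⟨r, hr⟩ := (hs hV).exists_pos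
  refine Absorbs.of_norm ⟨r, fun a ha => ?_⟩
  exact absConvexHull_min (hr.2 a ha) ⟨hVc.1.smul a, hVc.2.smul a⟩

theorem Bornology.IsVonNBounded.convexHull {s : Set E} (hs : Bornology.IsVonNBounded ℝ s) :
    Bornology.IsVonNBounded ℝ (convexHull ℝ s) :=
  hs.absConvexHull.subset (convexHull_min subset_absConvexHull convex_absConvexHull)

end Bounded

/-! ### Reduction to a non-dentable sequence -/

section CountableReduction

variable {E : Type u} [AddCommGroup E] [Module ℝ E] [UniformSpace E]
  [ContinuousSMul ℝ E] [LocallyConvexSpace ℝ E]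

/-- A bounded set which fails to be dentable contains a sequence which fails to be dentable. -/
theorem IsSBMSpace.exists_seq_mem_closure_convexHull (hE : IsSBMSpace E) {B V : Set E}
    (hne : B.Nonempty) (hB : Bornology.IsVonNBounded ℝ B)
    (h : ∀ x ∈ B, x ∈ closure (convexHull ℝ (B \ (x +ᵥ V)))) :
    ∃ b : ℕ → E, (∀ i, b i ∈ B) ∧
      ∀ i, b i ∈ closure (convexHull ℝ (range b \ (b i +ᵥ V))) := by
  have step : ∀ x : B, ∃ F : ℕ → B, (∀ j, (F j : E) ∉ (x : E) +ᵥ V) ∧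
      (x : E) ∈ closure (convexHull ℝ (range fun j => (F j : E))) := by
    intro x
    -- Condition (ii) makes `x` the limit of a sequence of convex combinations, which together
    -- involve only countably many points of `B`.
    obtain ⟨y, hy, hlim⟩ := hE.exists_seq _ ((hB.subset sdiff_subset).convexHull) _ (h x x.2)
    have hy' : ∀ n, ∃ t : Finset E, (t : Set E) ⊆ B \ ((x : E) +ᵥ V) ∧
        y n ∈ convexHull ℝ (t : Set E) := by
      intro n
      have := hy n
      rw [convexHull_eq_union_convexHull_finite_subsets] at this
      simpa using this
    choose t ht hyt using hy'
    have hcount : (⋃ n, (t n : Set E)).Countable := countable_iUnion fun n => (t n).countable_toSet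
    have hnon : (⋃ n, (t n : Set E)).Nonempty := by
      have h0 : (t 0 : Set E).Nonempty := convexHull_nonempty_iff.1 ⟨_, hyt 0⟩
      exact h0.mono (subset_iUnion (fun n => (t n : Set E)) 0)
    obtain ⟨F, hF⟩ := hcount.exists_eq_range hnon
    have hFmem : ∀ j, F j ∈ B \ ((x : E) +ᵥ V) := fun j =>
      iUnion_subset ht (hF ▸ mem_range_self j)
    refine ⟨fun j => ⟨F j, (hFmem j).1⟩, fun j => (hFmem j).2, ?_⟩
    refine mem_closure_of_tendsto hlim (Eventually.of_forall fun n => ?_)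
    exact convexHull_mono ((subset_iUnion (fun n => (t n : Set E)) n).trans hF.le) (hyt n)
  choose F hFV hFx using step
  obtain ⟨x₀, hx₀⟩ := hne
  -- A tree indexed by finite words: the children `j :: l` of the node `l` are the countably many
  -- points whose closed hull contains it.
  let b' : List ℕ → B := fun l => l.rec ⟨x₀, hx₀⟩ fun i _ x => F x i
  obtain ⟨e, he⟩ := exists_surjective_nat (List ℕ)
  let b : ℕ → E := fun i => (b' (e i)).1
  refine ⟨b, fun i => (b' (e i)).2, fun i => ?_⟩
  refine closure_mono (convexHull_mono ?_) (hFx (b' (e i)))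
  rintro _ ⟨j, rfl⟩
  obtain ⟨k, hk⟩ := he (j :: e i)
  have hbk : b k = F (b' (e i)) j := by
    change (b' (e k)).1 = _
    rw [hk]
  exact ⟨⟨k, hbk⟩, hFV _ j⟩

end CountableReduction

/-! ### Complete disks with countably many determining seminorms -/

section Disk

open scoped Uniformity

variable {E : Type u} [AddCommGroup E] [Module ℝ E] [UniformSpace E] [IsUniformAddGroup E]
  [ContinuousSMul ℝ E]

/-- Half of a difference of two points of `K` lies in `K`, so the uniformity of `K` is pulled back
from the neighborhoods of zero in `K`. A countable base at zero thus suffices to test completeness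
by sequences. -/
theorem isCountablyGenerated_uniformity_of_absConvex {K : Set E} (hK : AbsConvex ℝ K)
    (h0 : (0 : E) ∈ K) [FirstCountableTopology K] : (𝓤 K).IsCountablyGenerated := by
  have hmem : ∀ p : K × K, (2 : ℝ)⁻¹ • ((p.2 : E) - p.1) ∈ K := by
    rintro ⟨x, y⟩
    have hx : -(x : E) ∈ K := by simpa using hK.1.neg_mem_iff.2 x.2
    rw [sub_eq_add_neg, smul_add]
    exact hK.2 y.2 hx (by norm_num) (by norm_num) (by norm_num)
  have h2 : comap (fun x : E => (2 : ℝ)⁻¹ • x) (𝓝 0) = 𝓝 0 := by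
    have := (Homeomorph.smulOfNeZero (2 : ℝ)⁻¹ (by norm_num) : E ≃ₜ E).comap_nhds_eq 0
    simpa using this
  have key : 𝓤 K = comap (fun p : K × K => (⟨_, hmem p⟩ : K)) (𝓝 ⟨0, h0⟩) := by
    rw [nhds_subtype, comap_comap, uniformity_subtype, uniformity_eq_comap_nhds_zero, comap_comap]
    conv_lhs => rw [← h2]
    rw [comap_comap]
    rfl
  rw [key]
  infer_instance

/-- In an SBM-space a countable bounded set is contained in a complete disk whose topology at zero
is given by countably many neighborhoods. -/
theorem IsSBMSpace.exists_completeDisk [LocallyConvexSpace ℝ E] (hE : IsSBMSpace E)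
    {D : Set E} (hD : D.Countable) (hne : D.Nonempty) [T2Space E] (hDb : Bornology.IsVonNBounded ℝ D) :
    ∃ K : CompleteDisk E, D ⊆ K.carrier ∧ ∃ V : ℕ → AbsConvexNhd E,
      ∀ U ∈ 𝓝 (0 : E), ∃ i, K.carrier ∩ (V i).carrier ⊆ U := by
  set K := closure (absConvexHull ℝ D) with hKdef
  have hDK : D ⊆ K := subset_absConvexHull.trans subset_closure
  have hK : AbsConvex ℝ K := AbsConvex.closure absConvex_absConvexHull
  have hKb : Bornology.IsVonNBounded ℝ K := hDb.absConvexHull.closure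
  have hsep : TopologicalSpace.SeparableSpace K := hD.separableSpace_closure_absConvexHull
  have hmet := hE.metrizable K hKb hsep
  have h0 : (0 : E) ∈ K := hK.1.zero_mem (hne.mono hDK)
  have hcg := isCountablyGenerated_uniformity_of_absConvex hK h0
  have hcomp : IsComplete K := by
    rw [← completeSpace_coe_iff_isComplete]
    refine UniformSpace.complete_of_cauchySeq_tendsto fun x hx => ?_
    obtain ⟨y, hy, hlim⟩ := hE.seqComplete K isClosed_closure hKb hK.2 (fun n => x n)
      (fun n => (x n).2) (uniformContinuous_subtype_val.comp_cauchySeq hx)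
    exact ⟨⟨y, hy⟩, tendsto_subtype_rng.2 hlim⟩
  refine ⟨⟨K, hne.mono hDK, hcomp, hK, hKb⟩, hDK, ?_⟩
  obtain ⟨s, hs⟩ := (𝓝 (⟨0, h0⟩ : K)).exists_antitone_basis
  have hV : ∀ i, ∃ V : AbsConvexNhd E, ((↑) ⁻¹' V.carrier : Set K) ⊆ s i := by
    intro i
    have := hs.1.mem_of_mem (i := i) trivial
    rw [nhds_subtype, mem_comap] at this
    obtain ⟨U, hU, hUs⟩ := this
    obtain ⟨V, ⟨hV, hVc⟩, hVU⟩ := (nhds_hasBasis_absConvex ℝ E).mem_iff.1 hU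
    exact ⟨⟨V, hV, hVc⟩, (preimage_mono hVU).trans hUs⟩
  choose V hV using hV
  refine ⟨V, fun U hU => ?_⟩
  have hU' : ((↑) ⁻¹' U : Set K) ∈ 𝓝 (⟨0, h0⟩ : K) := by
    rw [nhds_subtype]
    exact preimage_mem_comap hU
  obtain ⟨i, -, hi⟩ := hs.1.mem_iff.1 hU'
  exact ⟨i, fun x hx => hi (hV i (a := ⟨x, hx.1⟩) hx.2)⟩

namespace CompleteDisk

variable [T2Space E] (K : CompleteDisk E)

theorem exists_incl_eq {x : E} {r : ℝ} (hr : 0 < r) (hx : x ∈ r • K.carrier) :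
    ∃ y : K.Space, K.incl y = x ∧ ‖y‖ ≤ r := by
  obtain ⟨n, hn⟩ := exists_nat_ge r
  have hmem : x ∈ K.submodule := ⟨n, K.absConvex.1.smul_mono (by
    rwa [Real.norm_of_nonneg hr.le, Real.norm_of_nonneg (Nat.cast_nonneg n)]) hx⟩
  exact ⟨⟨x, hmem⟩, rfl, K.gaugeOn_le_of_mem hr hx⟩

theorem norm_le_of_forall_mem_smul {x : K.Space} {r : ℝ} (hr : 0 ≤ r)
    (h : ∀ r' > r, K.incl x ∈ r' • K.carrier) : ‖x‖ ≤ r :=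
  le_of_forall_gt_imp_ge_of_dense fun r' hr' =>
    K.gaugeOn_le_of_mem (hr.trans_lt hr') (h r' hr')

/-- A sequence bounded in `E_K` and Cauchy for countably many seminorms which determine the
topology of `K` converges in `E`. -/
theorem exists_tendsto_incl {V : ℕ → AbsConvexNhd E}
    (hV : ∀ U ∈ 𝓝 (0 : E), ∃ i, K.carrier ∩ (V i).carrier ⊆ U) {y : ℕ → K.Space} {r : ℝ}
    (hr : ∀ n, ‖y n‖ ≤ r) (hy : ∀ i, CauchySeq fun n => (V i).toBanachSpace (K.incl (y n))) :
    ∃ L : K.Space, ‖L‖ ≤ r ∧ Tendsto (fun n => K.incl (y n)) atTop (𝓝 (K.incl L)) := by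
  have hr0 : 0 ≤ r := (norm_nonneg _).trans (hr 0)
  have hcau : CauchySeq fun n => K.incl (y n) := by
    rw [cauchySeq_iff_tendsto, uniformity_eq_comap_nhds_zero, tendsto_comap_iff, tendsto_def]
    intro U hU
    -- Differences have norm at most `2 * r < c`, so they lie in `c K` and, divided by `c`, can be
    -- tested by the neighborhoods that determine the topology of `K`.
    set c : ℝ := 2 * r + 1 with hc
    have hc0 : 0 < c := by positivity
    obtain ⟨i, hi⟩ := hV (c⁻¹ • U) ((set_smul_mem_nhds_zero_iff (inv_ne_zero hc0.ne')).2 hU)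
    obtain ⟨N, hN⟩ := Metric.cauchySeq_iff.1 (hy i) c hc0
    filter_upwards [eventually_ge_atTop (N, N)] with p hp
    have hdiff : K.incl (y p.2 - y p.1) ∈ c • K.carrier := by
      refine K.incl_mem_smul_of_norm_lt ((norm_sub_le _ _).trans_lt ?_)
      linarith [hr p.1, hr p.2]
    obtain ⟨k, hk, hkc⟩ := hdiff
    have hkV : k ∈ (V i).carrier := by
      refine setOfPred_gauge_lt_one_subset_self (V i).absConvex.2 (mem_of_mem_nhds (V i).mem_nhds)
        (absorbent_nhds_zero (V i).mem_nhds) ?_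
      have h1 := hN p.2 hp.2 p.1 hp.1
      rw [dist_eq_norm, ← map_sub, ← map_sub, ← hkc] at h1
      simp only [map_smul, norm_smul, Real.norm_of_nonneg hc0.le] at h1
      rw [(V i).norm_toBanachSpace] at h1
      exact (mul_lt_iff_lt_one_right hc0).1 h1
    have := hi ⟨hk, hkV⟩
    rw [mem_inv_smul_set_iff₀ hc0.ne'] at this
    simp only [mem_preimage, Function.comp_apply, Prod.map_fst, Prod.map_snd, ← map_sub]
    rw [← hkc]
    exact this
  have hR : 0 < r + 1 := by positivity
  obtain ⟨k, hk, hlim⟩ := cauchySeq_tendsto_of_isComplete K.isComplete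
    (u := fun n => (r + 1)⁻¹ • K.incl (y n)) (fun n => by
      rw [← mem_smul_set_iff_inv_smul_mem₀ hR.ne']
      exact K.incl_mem_smul_of_norm_lt ((hr n).trans_lt (lt_add_one r)))
    (((r + 1)⁻¹ • ContinuousLinearMap.id ℝ E).uniformContinuous.comp_cauchySeq hcau)
  obtain ⟨L, hL, -⟩ := K.exists_incl_eq hR (smul_mem_smul_set hk)
  have hlim' : Tendsto (fun n => K.incl (y n)) atTop (𝓝 (K.incl L)) := by
    rw [hL]
    simpa [smul_smul, hR.ne'] using hlim.const_smul (r + 1)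
  -- Convergence holds in `E` only, not in the norm of `E_K`; the bound survives because every `r'
  -- K` is closed in `E`.
  refine ⟨L, K.norm_le_of_forall_mem_smul hr0 fun r' hr' => ?_, hlim'⟩
  have hclosed : IsClosed (r' • K.carrier) :=
    K.isComplete.isClosed.smul_of_ne_zero (hr0.trans_lt hr').ne'
  exact hclosed.mem_of_tendsto hlim' (Eventually.of_forall fun n =>
    K.incl_mem_smul_of_norm_lt ((hr n).trans_lt hr'))

end CompleteDisk

end Disk

/-! ### Barycenters -/

section Barycenter

variable {E : Type u} [AddCommGroup E] [Module ℝ E] [TopologicalSpace E]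

/-- A point of the convex hull is the barycenter of a probability measure. -/
theorem exists_isProbabilityMeasure_integral_eq {S : Type*} [MeasurableSpace S]
    [DiscreteMeasurableSpace S] [Countable S]
    (b : S → E) {J : Set S} {x : E} (hx : x ∈ convexHull ℝ (b '' J)) :
    ∃ q : Measure S, IsProbabilityMeasure q ∧ (∀ᵐ t ∂q, t ∈ J) ∧
      ∀ (Z : Type u) [NormedAddCommGroup Z] [NormedSpace ℝ Z] [CompleteSpace Z] (T : E →L[ℝ] Z),
        Integrable (fun t => T (b t)) q ∧ ∫ t, T (b t) ∂q = T x := by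
  -- Dirac measures represent the points of `b '' J`, and mixtures make the set of barycenters
  -- convex.
  refine convexHull_min (t := {x | ∃ q : Measure S, IsProbabilityMeasure q ∧ (∀ᵐ t ∂q, t ∈ J) ∧
      ∀ (Z : Type u) [NormedAddCommGroup Z] [NormedSpace ℝ Z] [CompleteSpace Z] (T : E →L[ℝ] Z),
        Integrable (fun t => T (b t)) q ∧ ∫ t, T (b t) ∂q = T x}) ?_ ?_ hx
  · rintro _ ⟨s, hs, rfl⟩
    refine ⟨Measure.dirac s, inferInstance, by simpa [ae_dirac_eq] using hs,
      fun Z _ _ _ T => ⟨integrable_dirac (by simp), by simp⟩⟩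
  · rintro x ⟨q, hq, hqJ, hqT⟩ y ⟨q', hq', hqJ', hqT'⟩ c d hc hd hcd
    refine ⟨ENNReal.ofReal c • q + ENNReal.ofReal d • q', ⟨?_⟩, ?_, fun Z _ _ _ T => ⟨?_, ?_⟩⟩
    · simp [← ENNReal.ofReal_add hc hd, hcd]
    · rw [ae_add_measure_iff]
      exact ⟨Measure.ae_smul_measure hqJ _, Measure.ae_smul_measure hqJ' _⟩
    · exact ((hqT Z T).1.smul_measure ENNReal.ofReal_ne_top).add_measure
        ((hqT' Z T).1.smul_measure ENNReal.ofReal_ne_top)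
    · rw [integral_add_measure ((hqT Z T).1.smul_measure ENNReal.ofReal_ne_top)
        ((hqT' Z T).1.smul_measure ENNReal.ofReal_ne_top), integral_smul_measure,
        integral_smul_measure, (hqT Z T).2, (hqT' Z T).2, ENNReal.toReal_ofReal hc,
        ENNReal.toReal_ofReal hd]
      simp

end Barycenter

/-! ### The Radon–Nikodym property implies dentability -/

section NonDentable

variable {E : Type u} [AddCommGroup E] [Module ℝ E] [UniformSpace E] [IsUniformAddGroup E]
  [ContinuousSMul ℝ E] [T2Space E]

/-- The vector measure with values in `E_K` obtained as the limit of the integrals of a chain. -/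
theorem CompleteDisk.exists_vectorMeasure_of_tendsto (K : CompleteDisk E) {Ω : Type*}
    [MeasurableSpace Ω] {μ : Measure Ω} [IsFiniteMeasure μ] {h : ℕ → Ω → K.Space}
    (hint : ∀ n, Integrable (h n) μ)
    (hlim : ∀ A, MeasurableSet A → ∃ L : K.Space, ‖L‖ ≤ μ.real A ∧
      Tendsto (fun n => K.incl (∫ ω in A, h n ω ∂μ)) atTop (𝓝 (K.incl L))) :
    ∃ m : VectorMeasure Ω K.Space, (∀ A, ‖m A‖ₑ ≤ μ A) ∧ ∀ A, MeasurableSet A →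
      Tendsto (fun n => K.incl (∫ ω in A, h n ω ∂μ)) atTop (𝓝 (K.incl (m A))) := by
  classical
  choose! L hL hLlim using hlim
  set m : Set Ω → K.Space := fun A => if MeasurableSet A then L A else 0 with hm
  have hmA : ∀ A, MeasurableSet A → m A = L A := fun A hA => if_pos hA
  have hle : ∀ A, ‖m A‖ₑ ≤ μ A := by
    intro A
    by_cases hA : MeasurableSet A
    · rw [hmA A hA, ← ofReal_norm, ← ofReal_measureReal]
      exact ENNReal.ofReal_le_ofReal (hL A hA)
    · simp [hm, hA]
  have hadd : ∀ A B, MeasurableSet A → MeasurableSet B → Disjoint A B →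
      m (A ∪ B) = m A + m B := by
    intro A B hA hB hAB
    rw [hmA A hA, hmA B hB, hmA _ (hA.union hB)]
    -- Additivity is checked in `E`, where limits are unique; countable additivity then follows from
    -- domination by `μ`.
    apply K.inclₗ_injective
    rw [map_add]
    refine tendsto_nhds_unique (hLlim _ (hA.union hB)) ?_
    refine ((hLlim A hA).add (hLlim B hB)).congr fun n => ?_
    rw [← map_add, setIntegral_union hAB hB (hint n).integrableOn (hint n).integrableOn]
  refine ⟨VectorMeasure.of_additive_of_le_measure m hle hadd fun A hA => if_neg hA, hle,
    fun A hA => ?_⟩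
  change Tendsto _ _ (𝓝 (K.incl (m A)))
  rw [hmA A hA]
  exact hLlim A hA

/-- In a space with the Radon–Nikodym property no bounded sequence in a suitable complete disk
is non-dentable. -/
theorem HasRNP.not_forall_mem_closure_convexHull (hRNP : HasRNP.{w} E) {S : Type w} [Countable S]
    [Nonempty S] (b : S → E) (V₀ : AbsConvexNhd E) (K : CompleteDisk E)
    (hK : range b ⊆ K.carrier) (V : ℕ → AbsConvexNhd E)
    (hV : ∀ U ∈ 𝓝 (0 : E), ∃ i, K.carrier ∩ (V i).carrier ⊆ U) :
    ¬ ∀ s, b s ∈ closure (convexHull ℝ (range b \ (b s +ᵥ V₀.carrier))) := by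
  intro hb
  let _ : MeasurableSpace S := ⊤
  have : DiscreteMeasurableSpace S := ⟨fun _ => trivial⟩
  -- Placing `V₀` at index zero controls the drift also in the seminorm in which the jumps are at
  -- least one.
  set W : ℕ → AbsConvexNhd E := fun i => i.casesOn V₀ V with hW
  have hWbasis : ∀ U ∈ 𝓝 (0 : E), ∃ i, K.carrier ∩ (W i).carrier ⊆ U := fun U hU =>
    let ⟨i, hi⟩ := hV U hU
    ⟨i + 1, hi⟩
  -- the transition probabilities
  have hq : ∀ (n : ℕ) (s : S), ∃ q : Measure S, IsProbabilityMeasure q ∧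
      (∀ᵐ t ∂q, b t ∉ b s +ᵥ V₀.carrier) ∧
      ∀ i ≤ n, ‖∫ t, (W i).toBanachSpace (b t) ∂q - (W i).toBanachSpace (b s)‖ ≤
        (1 / 2) ^ n := by
    intro n s
    -- Finitely many seminorms are controlled at each time, and the `i`-th one at all times `n ≥ i`,
    -- which is enough for summable drift.
    have hN : {x : E | ∀ i ∈ Finset.range (n + 1),
        ‖(W i).toBanachSpace x - (W i).toBanachSpace (b s)‖ < (1 / 2) ^ n} ∈ 𝓝 (b s) := by
      change ∀ᶠ x in 𝓝 (b s), ∀ i ∈ Finset.range (n + 1), _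
      rw [eventually_all_finset]
      intro i _
      have h1 : Tendsto (fun x => ‖(W i).toBanachSpace x - (W i).toBanachSpace (b s)‖)
          (𝓝 (b s)) (𝓝 0) := by
        rw [← tendsto_iff_norm_sub_tendsto_zero]
        exact (W i).toBanachSpace.continuous.tendsto _
      exact h1.eventually_lt_const (by positivity)
    obtain ⟨x, hxN, hx⟩ := mem_closure_iff_nhds.1 (hb s) _ hN
    have himg : range b \ (b s +ᵥ V₀.carrier) = b '' {t | b t ∉ b s +ᵥ V₀.carrier} := by
      ext y
      constructor
      · rintro ⟨⟨t, rfl⟩, ht⟩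
        exact ⟨t, ht, rfl⟩
      · rintro ⟨t, ht, rfl⟩
        exact ⟨⟨t, rfl⟩, ht⟩
    rw [himg] at hx
    obtain ⟨q, hq, hqJ, hqT⟩ := exists_isProbabilityMeasure_integral_eq b hx
    refine ⟨q, hq, hqJ, fun i hi => ?_⟩
    rw [(hqT _ (W i).toBanachSpace).2]
    exact (hxN i (Finset.mem_range.2 (Nat.lt_succ_of_le hi))).le
  choose q hqprob hqjump hqdrift using hq
  obtain ⟨μ, hμprob, hμ⟩ := exists_isMarkovChainLaw q
  -- the chain with values in `E_K`
  have hlift : ∀ s, ∃ y : K.Space, K.incl y = b s ∧ ‖y‖ ≤ 1 := fun s =>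
    K.exists_incl_eq one_pos (by rw [one_smul]; exact hK (mem_range_self s))
  choose y hyb hy using hlift
  set Ψ : ∀ i, K.Space →L[ℝ] (W i).BanachSpace := fun i => (W i).toBanachSpace ∘L K.incl with hΨ
  have hΨy : ∀ i s, Ψ i (y s) = (W i).toBanachSpace (b s) := fun i s => by
    rw [← hyb s]
    rfl
  have hyint := fun n => integrable_comp_eval (μ := μ) hy n
  have hΨint : ∀ i n (A : Set (ℕ → S)), (W i).toBanachSpace (K.incl (∫ ω in A, y (ω n) ∂μ)) =
      ∫ ω in A, (W i).toBanachSpace (b (ω n)) ∂μ := by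
    intro i n A
    change Ψ i _ = _
    rw [← (Ψ i).integral_comp_comm (hyint n).integrableOn]
    simp_rw [hΨy]
  have hbound : ∀ i s, ‖(W i).toBanachSpace (b s)‖ ≤ ‖Ψ i‖ := fun i s => by
    rw [← hΨy]
    exact ((Ψ i).le_opNorm _).trans (mul_le_of_le_one_right (norm_nonneg _) (hy s))
  have hdrift : ∀ i, ∀ᶠ n in atTop, ∀ s,
      ‖∫ t, (W i).toBanachSpace (b t) ∂q n s - (W i).toBanachSpace (b s)‖ ≤ (1 / 2) ^ n := by
    intro i
    filter_upwards [eventually_ge_atTop i] with n hn s using hqdrift n s i hn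
  obtain ⟨m, hm, hmlim⟩ := K.exists_vectorMeasure_of_tendsto (μ := μ) hyint fun A hA => by
    refine K.exists_tendsto_incl hWbasis (fun n => ?_) fun i => ?_
    · refine (norm_setIntegral_le_of_norm_le_const (measure_lt_top μ A)
        fun ω _ => hy (ω n)).trans_eq (one_mul _)
    · simp_rw [hΨint]
      exact hμ.cauchySeq_setIntegral (hbound i) (hdrift i) hA
  have hvar : m.variation univ ≠ ∞ :=
    ((VectorMeasure.variation_le_of_forall_enorm_le fun A _ => hm A) univ).trans_lt
      (measure_lt_top μ univ) |>.ne
  have hac : m ≪ᵥ μ.toENNRealVectorMeasure := by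
    refine VectorMeasure.AbsolutelyContinuous.mk fun A hA hA0 => ?_
    rw [Measure.toENNRealVectorMeasure_apply_measurable hA] at hA0
    have := hm A
    rwa [hA0, nonpos_iff_eq_zero, enorm_eq_zero] at this
  obtain ⟨f, hf, hfA⟩ := hRNP K V₀ (ℕ → S) μ m hvar hac
  refine hμ.not_exists_density (hbound 0) (hdrift 0) (fun n s => ?_) hf fun A hA => ?_
  · filter_upwards [hqjump n s] with t ht
    rw [← map_sub]
    change 1 ≤ ‖V₀.toBanachSpace (b t - b s)‖
    rw [V₀.norm_toBanachSpace]
    by_contra hlt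
    refine ht ?_
    rw [mem_vadd_set_iff_neg_vadd_mem, vadd_eq_add, neg_add_eq_sub]
    exact setOfPred_gauge_lt_one_subset_self V₀.absConvex.2 (mem_of_mem_nhds V₀.mem_nhds)
      (absorbent_nhds_zero V₀.mem_nhds) (not_le.1 hlt)
  · rw [← hfA A hA]
    have := (V₀.toBanachSpace.continuous.tendsto _).comp (hmlim A hA)
    refine this.congr fun n => ?_
    exact hΨint 0 n A

theorem IsSBMSpace.isDentable_of_hasRNP [LocallyConvexSpace ℝ E] (hE : IsSBMSpace E)
    (hRNP : HasRNP.{w} E) {B : Set E} (hne : B.Nonempty) (hB : Bornology.IsVonNBounded ℝ B) : IsDentable B := by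
  intro V hV hVc
  by_contra! h
  obtain ⟨b, hbB, hb⟩ := hE.exists_seq_mem_closure_convexHull (V := V) hne hB h
  obtain ⟨K, hK, W, hW⟩ := hE.exists_completeDisk (countable_range b) (range_nonempty b)
    (hB.subset (range_subset_iff.2 hbB))
  -- The lift puts the path space into the universe `w` of the measure spaces in `HasRNP`.
  have hrange : range (fun s : ULift.{w} ℕ => b s.down) = range b :=
    ULift.down_surjective.range_comp b
  refine hRNP.not_forall_mem_closure_convexHull (S := ULift.{w} ℕ) (fun s => b s.down)
    ⟨V, hV, hVc⟩ K (hrange ▸ hK) W hW fun s => ?_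
  rw [hrange]
  exact hb s.down

end NonDentable

theorem mainTheorem2 {E : Type u} [AddCommGroup E] [Module ℝ E] [UniformSpace E]
    [IsUniformAddGroup E] [ContinuousSMul ℝ E] [LocallyConvexSpace ℝ E] [T2Space E] :
    (IsSBMSpace E →
      List.TFAE [
        HasRNP.{w} E,
        ∀ B : Set E, B.Nonempty → Bornology.IsVonNBounded ℝ B → IsDentable B,
        ∀ B : Set E, B.Nonempty → Bornology.IsVonNBounded ℝ B → IsSDentable B,
        ∀ B : Set E, B.Nonempty → Bornology.IsVonNBounded ℝ B → IsFDentable B]) ∧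
    (QuasiCompleteSpace ℝ E ∧ HasMetrizableBoundedSets E → IsSBMSpace E) ∧
    (IsFrechetSpace E → IsSBMSpace E) := by
  refine ⟨fun hE => ?_, fun ⟨_, h⟩ => isSBMSpace_of_quasiComplete h,
    IsFrechetSpace.isSBMSpace⟩
  tfae_have 1 → 2 := fun h _ hne hB => hE.isDentable_of_hasRNP h hne hB
  tfae_have 2 → 3 := fun h B hne hB => (h B hne hB).isSDentable
  tfae_have 3 → 4 := fun h B hne hB => (h B hne hB).isFDentable
  tfae_have 4 → 1 := hasRNP_of_forall_isFDentable
  tfae_finish
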